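/- All graphs are finite. For a family $\mathcal F$ of graphs, $\mathrm{Forb}(\mathcal F)$ is the class of graphs containing no member of $\mathcal F$ as an induced subgraph; it is non-trivial if it contains graphs of unbounded order. A CRG $K$ is a complete graph on a finite non-empty vertex set $V(K)$ together with partitions $V(K)=VB(K)\sqcup VW(K)$ of its vertices into black and white and $E(K)=EB(K)\sqcup EW(K)\sqcup EG(K)$ of its edges into black, white and gray; CRGs are considered up to isomorphism. A sub-CRG is obtained by restricting $K$ to a non-empty set of vertices. For a graph $F$, write $F\mapsto K$ if there is a map $\varphi\colon V(F)\to V(K)$ such that for every edge $uv$ of $F$ either $\varphi(u)=\varphi(v)\in VB(K)$ or $\varphi(u)\varphi(v)\in EB(K)\cup EG(K)$, and for all distinct non-adjacent $u,v$ either $\varphi(u)=\varphi(v)\in VW(K)$ or $\varphi(u)\varphi(v)\in EW(K)\cup EG(K)$. Write $\mathcal F\mapsto K$ if $F\mapsto K$ for some $F\in\mathcal F$, and $\mathcal F\not\mapsto K$ otherwise. For $p\in[0,1]$ let $M_K(p)$ be the symmetric matrix indexed by $V(K)$ whose $(x,y)$ entry is $p$ if $x=y\in VW(K)$ or $xy\in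 EW(K)$, is $1-p$ if $x=y\in VB(K)$ or $xy\in EB(K)$, and is $0$ if $xy\in EG(K)$. Let $g_K(p)=\min_\mu\langle\mu,M_K(p)\mu\rangle$ over all probability masses $\mu$ on $V(K)$. For $p\in(0,1)$, $K$ is $p$-core if $g_{K'}(p)>g_K(p)$ for every proper sub-CRG $K'$ of $K$. $K$ is $0$-core if it has no black edges and every white edge joins two black vertices; $K$ is $1$-core if it has no white edges and every black edge joins two white vertices. For $p\in[0,1]$ and $\mathcal H=\mathrm{Forb}(\mathcal F)$, let $\mathcal K_p(\mathcal H)$ be the set of all $p$-core CRGs $K$ with $\mathcal F\not\mapsto K$. A dalmatian CRG of size $\ell$ consists of $\ell$ black vertices with all edges white. If $K$ is $0$-core (as is every $p$-core CRG with $0<p\le 1/2$), then $K^\ell(r)$ denotes the CRG obtained from $K$ by replacing $r$ of its white vertices by dalmatian CRGs of size $\ell$ and otherwise leaving $K$ unchanged; up to isomorphism it does not depend on which $r$ white vertices are replaced. **Theorem.** Let $\mathcal F$ be a non-empty family of graphs such that $\mathcal H=\mathrm{Forb}(\mathcal F)$ is non-trivial, and let $p\in(0,1/2)$. Suppose that there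 are a sequence $(p_n)$ in $[0,1]$ with $p_n\to p$ and pairwise distinct (i.e. pairwise non-isomorphic) CRGs $\Gamma_n\in\mathcal K_{p_n}(\mathcal H)$ with $\limsup_{n\to\infty}|VW(\Gamma_n)|=w$. Then there is a $p$-core CRG $K$ such that 1. $K\in\mathcal K_p(\mathcal H)$; 2. $g_K(p)\le\limsup_{n\to\infty}g_{\Gamma_n}(p_n)$; 3. $|VW(K)|=s>w$; 4. for all integers $1\le r\le s-w$ and all $\ell\ge 1$, $\mathcal F\not\mapsto K^\ell(r)$. -/

import Mathlib

open Filter Topology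

/-- A finite graph. -/
structure FinGraph where
  V : Type
  [fintypeV : Fintype V]
  graph : SimpleGraph V

attribute [instance] FinGraph.fintypeV

/-- `Forb 𝓕`: all finite graphs that contain no member of `𝓕` as an induced subgraph. -/
def Forb (𝓕 : Set FinGraph) : Set FinGraph :=
  {G | ∀ F ∈ 𝓕, ¬ F.graph.IsIndContained G.graph}

/-- A graph property is non-trivial if it contains graphs of unbounded order. -/
def NontrivialProperty (𝓗 : Set FinGraph) : Prop :=
  ∀ N : ℕ, ∃ G ∈ 𝓗, N ≤ Fintype.card G.V

/-- The two colours of the vertices of a CRG. -/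
inductive VColor : Type
  | black
  | white

/-- The three colours of the edges of a CRG. -/
inductive EColor : Type
  | black
  | white
  | gray

/-- A colored regularity graph: a clique on a finite nonempty vertex set whose vertices are
black or white and whose edges are black, white or gray.  The colour of the edge `xy`, for
`x ≠ y`, is `ecol x y`; the values `ecol x x` carry no meaning and are never used. -/
structure CRG where
  V : Type
  [fintypeV : Fintype V]
  [nonemptyV : Nonempty V]
  vcol : V → VColor
  ecol : V → V → EColor
  ecol_symm : ∀ x y, ecol x y = ecol y x

attribute [instance] CRG.fintypeV CRG.nonemptyV

namespace CRG

open Classical in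
/-- The set of white vertices. -/
noncomputable def VW (K : CRG) : Finset K.V :=
  Finset.univ.filter fun x => K.vcol x = VColor.white

/-- Isomorphism of CRGs. -/
def Iso (K L : CRG) : Prop :=
  ∃ e : K.V ≃ L.V, (∀ x, L.vcol (e x) = K.vcol x) ∧
    ∀ x y, x ≠ y → L.ecol (e x) (e y) = K.ecol x y

/-- The sub-CRG of `K` induced by a nonempty set of vertices. -/
noncomputable def induce (K : CRG) (s : Set K.V) (hs : s.Nonempty) : CRG :=
  haveI : Nonempty s := hs.to_subtype
  { V := s
    fintypeV := Fintype.ofFinite s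
    vcol := fun x => K.vcol x
    ecol := fun x y => K.ecol x y
    ecol_symm := fun x y => K.ecol_symm x y }

/-- `F.MapsTo K` is the relation `F ↦ K`. -/
def _root_.FinGraph.MapsTo (F : FinGraph) (K : CRG) : Prop :=
  ∃ φ : F.V → K.V,
    (∀ u v, F.graph.Adj u v →
      (φ u = φ v ∧ K.vcol (φ u) = VColor.black) ∨
      (φ u ≠ φ v ∧
        (K.ecol (φ u) (φ v) = EColor.black ∨ K.ecol (φ u) (φ v) = EColor.gray))) ∧
    (∀ u v, u ≠ v → ¬ F.graph.Adj u v →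
      (φ u = φ v ∧ K.vcol (φ u) = VColor.white) ∨
      (φ u ≠ φ v ∧
        (K.ecol (φ u) (φ v) = EColor.white ∨ K.ecol (φ u) (φ v) = EColor.gray)))

/-- `𝓕 ↦ K`: some member of the family maps to `K`. -/
def FamilyMapsTo (𝓕 : Set FinGraph) (K : CRG) : Prop :=
  ∃ F ∈ 𝓕, F.MapsTo K

/-- The weight of a vertex colour: a diagonal entry of `M_K(p)`. -/
def _root_.VColor.weight (p : ℝ) : VColor → ℝ
  | VColor.black => 1 - p
  | VColor.white => p

/-- The weight of an edge colour: an off-diagonal entry of `M_K(p)`. -/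
def _root_.EColor.weight (p : ℝ) : EColor → ℝ
  | EColor.black => 1 - p
  | EColor.white => p
  | EColor.gray => 0

open Classical in
/-- The matrix `M_K(p)`. -/
noncomputable def M (K : CRG) (p : ℝ) : Matrix K.V K.V ℝ :=
  Matrix.of fun x y => if x = y then (K.vcol x).weight p else (K.ecol x y).weight p

/-- The function `g_K(p)`: the minimum of `⟨μ, M_K(p) μ⟩` over all probability masses `μ` on the
vertex set (see `isLeast_g`). -/
noncomputable def g (K : CRG) (p : ℝ) : ℝ :=
  sInf ((fun μ : K.V → ℝ => μ ⬝ᵥ (K.M p).mulVec μ) '' stdSimplex ℝ K.V)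

/-- The infimum in the definition of `g_K(p)` is attained. -/
theorem isLeast_g (K : CRG) (p : ℝ) :
    IsLeast ((fun μ : K.V → ℝ => μ ⬝ᵥ (K.M p).mulVec μ) '' stdSimplex ℝ K.V) (K.g p) := by
  classical
  have hc : Continuous fun μ : K.V → ℝ => μ ⬝ᵥ (K.M p).mulVec μ := by
    fun_prop
  refine ((isCompact_stdSimplex ℝ K.V).image hc).isLeast_sInf ?_
  exact Set.Nonempty.image _ ⟨_, single_mem_stdSimplex ℝ (Classical.arbitrary K.V)⟩

/-- `0`-core CRGs: every edge is white or gray, and every white edge joins two black vertices. -/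
def IsZeroCore (K : CRG) : Prop :=
  ∀ x y, x ≠ y → K.ecol x y = EColor.gray ∨
    (K.ecol x y = EColor.white ∧ K.vcol x = VColor.black ∧ K.vcol y = VColor.black)

/-- `1`-core CRGs: every edge is black or gray, and every black edge joins two white vertices. -/
def IsOneCore (K : CRG) : Prop :=
  ∀ x y, x ≠ y → K.ecol x y = EColor.gray ∨
    (K.ecol x y = EColor.black ∧ K.vcol x = VColor.white ∧ K.vcol y = VColor.white)

/-- `p`-core CRGs for `p ∈ [0,1]`: for `0 < p < 1`, every proper sub-CRG has a strictly larger
value of `g` at `p`; the cases `p = 0` and `p = 1` are defined structurally. -/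
def IsCore (K : CRG) (p : ℝ) : Prop :=
  (p = 0 ∧ K.IsZeroCore) ∨ (p = 1 ∧ K.IsOneCore) ∨
    (0 < p ∧ p < 1 ∧
      ∀ (s : Set K.V) (hs : s.Nonempty), s ≠ Set.univ → K.g p < (K.induce s hs).g p)

/-- The class `𝓚_p(Forb 𝓕)` of all `p`-core CRGs `K` with `𝓕 ↦ K` false. -/
def coreClass (𝓕 : Set FinGraph) (p : ℝ) : Set CRG :=
  {K | K.IsCore p ∧ ¬ FamilyMapsTo 𝓕 K}

/-- The vertex of `K` that a vertex of `K.dalmatian S ℓ` comes from. -/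
def dalmatianBase (K : CRG) (S : Finset K.V) (ℓ : ℕ) :
    {x : K.V // x ∉ S} ⊕ ({x : K.V // x ∈ S} × Fin ℓ) → K.V
  | Sum.inl x => x
  | Sum.inr z => z.1

open Classical in
/-- The CRG obtained from `K` by replacing each vertex in `S` by a dalmatian CRG of size `ℓ`
(that is, `ℓ` black vertices with all white edges) and otherwise leaving `K` unchanged. -/
noncomputable def dalmatian (K : CRG) (S : Finset K.V) (ℓ : ℕ) (hℓ : 1 ≤ ℓ) : CRG where
  V := {x : K.V // x ∉ S} ⊕ ({x : K.V // x ∈ S} × Fin ℓ)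
  nonemptyV := by
    obtain ⟨x⟩ := K.nonemptyV
    by_cases hx : x ∈ S
    · exact ⟨Sum.inr (⟨x, hx⟩, ⟨0, hℓ⟩)⟩
    · exact ⟨Sum.inl ⟨x, hx⟩⟩
  vcol
    | Sum.inl x => K.vcol x
    | Sum.inr _ => VColor.black
  ecol := fun a b =>
    if K.dalmatianBase S ℓ a = K.dalmatianBase S ℓ b then EColor.white
    else K.ecol (K.dalmatianBase S ℓ a) (K.dalmatianBase S ℓ b)
  ecol_symm := by
    intro a b
    simp only [eq_comm (a := K.dalmatianBase S ℓ a), K.ecol_symm (K.dalmatianBase S ℓ a)]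

end CRG

/-!
# Limits of core colored regularity graphs

Let `Γ` be a `q`-core CRG with `0 < q < 1 / 2`.  Its optimal mass `μ` has full support and satisfies
`M μ = g` (`CRG.IsCore.exists_optimal`).  This has two consequences.

* `Γ` is zero-core (`CRG.IsCore.isZeroCore`): white vertices send only gray edges and there are no
  black edges.
* Zykov symmetrization (`CRG.sum_whiten_collapse_le`): let a vertex `x` become white and gray to all
  others, and move onto `x` the mass of all vertices that are not gray neighbours of `x`.  The value
  does not increase.

Suppose that `Γ` has very many vertices but few white ones.  For each black `x` the symmetrization at
`x` is approximated on a sample of boundedly many vertices, and by averaging one sample serves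
a positive proportion of all black `x` (`CRG.IsCore.exists_sample`).  By the pigeonhole principle
many black vertices have the same gray neighbours in the sample.  Let `x` be one of them.  The
symmetrization at `x`, restricted to these neighbours, to `x` and to the white vertices, is a CRG of
bounded size, with almost the same value and one white vertex more than `Γ`.  Whatever maps to it
after `x` has been replaced by a dalmatian CRG maps to `Γ`, since the black vertices of the dalmatian
can be placed on the black vertices with the same trace (`CRG.exists_whiten_avoids`).

Maps to `K^ℓ(r)` for unspecified `ℓ` are expressed by `FinGraph.ClusterMapsTo`: on the fibre over a
replaced vertex adjacency is an equivalence relation.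

As there are finitely many CRGs of each size, the construction yields, for each `ε`, a `p`-core CRG
of value at most `limsup g + ε` with an additional replaceable white vertex.  If the sizes of these
CRGs stay bounded as `ε → 0`, then one of them has value at most `limsup g`.  If not, they are
arbitrarily large core CRGs themselves, and the construction is applied to them.  White vertices of a
zero-core CRG form a gray clique, to which every graph of no larger order maps, so that this ends
after finitely many rounds (`CRG.exists_core_of_large`).  Passing to a `p`-core sub-CRG loses no white
vertex (`CRG.IsEmb.mem_range_of_mem_VW`).
-/

namespace CRG

/-! ### The value `g` and embeddings -/

theorem M_apply_self (K : CRG) (p : ℝ) (x : K.V) : K.M p x x = (K.vcol x).weight p := by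
  simp [M]

theorem M_apply_ne (K : CRG) (p : ℝ) {x y : K.V} (h : x ≠ y) :
    K.M p x y = (K.ecol x y).weight p := by
  simp [M, h]

theorem M_comm (K : CRG) (p : ℝ) (x y : K.V) : K.M p x y = K.M p y x := by
  by_cases h : x = y
  · rw [h]
  · rw [M_apply_ne _ _ h, M_apply_ne _ _ (Ne.symm h), K.ecol_symm]

theorem M_nonneg (K : CRG) {p : ℝ} (hp0 : 0 ≤ p) (hp1 : p ≤ 1) (x y : K.V) : 0 ≤ K.M p x y := by
  by_cases h : x = y
  · subst h
    rw [M_apply_self]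
    cases K.vcol x <;> simp [VColor.weight] <;> linarith
  · rw [M_apply_ne _ _ h]
    cases K.ecol x y <;> simp [EColor.weight] <;> linarith

theorem M_le_one (K : CRG) {p : ℝ} (hp0 : 0 ≤ p) (hp1 : p ≤ 1) (x y : K.V) : K.M p x y ≤ 1 := by
  by_cases h : x = y
  · subst h
    rw [M_apply_self]
    cases K.vcol x <;> simp [VColor.weight] <;> linarith
  · rw [M_apply_ne _ _ h]
    cases K.ecol x y <;> simp [EColor.weight] <;> linarith

theorem abs_M_sub_le (K : CRG) (p q : ℝ) (x y : K.V) : |K.M p x y - K.M q x y| ≤ |p - q| := by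
  by_cases h : x = y
  · subst h
    rw [M_apply_self, M_apply_self]
    cases K.vcol x <;> simp [VColor.weight, abs_sub_comm]
  · rw [M_apply_ne _ _ h, M_apply_ne _ _ h]
    cases K.ecol x y <;> simp [EColor.weight, abs_sub_comm]

theorem dotProduct_M_mulVec (K : CRG) (p : ℝ) (μ : K.V → ℝ) :
    μ ⬝ᵥ (K.M p).mulVec μ = ∑ x, ∑ y, μ x * μ y * K.M p x y := by
  simp only [dotProduct, Matrix.mulVec, Finset.mul_sum]
  exact Finset.sum_congr rfl fun x _ => Finset.sum_congr rfl fun y _ => by ring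

theorem exists_sum_eq_g (K : CRG) (p : ℝ) :
    ∃ μ ∈ stdSimplex ℝ K.V, ∑ x, ∑ y, μ x * μ y * K.M p x y = K.g p := by
  obtain ⟨μ, hμ, h⟩ := (K.isLeast_g p).1
  exact ⟨μ, hμ, by rw [← h, ← dotProduct_M_mulVec]⟩

/-- A probability mass on any finite type that is mapped into `K` bounds `g_K(p)` from above:
push it forward. -/
theorem g_le_sum (K : CRG) (p : ℝ) {ι : Type*} [Fintype ι] {μ : ι → ℝ}
    (hμ : μ ∈ stdSimplex ℝ ι) (f : ι → K.V) :
    K.g p ≤ ∑ i, ∑ j, μ i * μ j * K.M p (f i) (f j) := by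
  classical
  set ν : K.V → ℝ := fun v => ∑ i, if f i = v then μ i else 0 with hν
  have key : ∀ k : K.V → ℝ, ∑ v, ν v * k v = ∑ i, μ i * k (f i) := by
    intro k
    simp only [hν, Finset.sum_mul]
    rw [Finset.sum_comm]
    exact Finset.sum_congr rfl fun i _ => by simp
  have hmem : ν ∈ stdSimplex ℝ K.V := by
    refine ⟨fun v => Finset.sum_nonneg fun i _ => ?_, ?_⟩
    · split_ifs
      exacts [hμ.1 i, le_rfl]
    · have := key fun _ => 1
      simpa [hμ.2] using this
  refine ((K.isLeast_g p).2 ⟨ν, hmem, rfl⟩).trans_eq ?_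
  simp only [dotProduct_M_mulVec, mul_assoc, ← Finset.mul_sum]
  rw [key fun v => ∑ w, ν w * K.M p v w]
  exact Finset.sum_congr rfl fun i _ => by rw [key fun w => K.M p (f i) w]

theorem g_nonneg (K : CRG) {p : ℝ} (hp0 : 0 ≤ p) (hp1 : p ≤ 1) : 0 ≤ K.g p := by
  obtain ⟨μ, hμ, h⟩ := K.exists_sum_eq_g p
  rw [← h]
  exact Finset.sum_nonneg fun x _ => Finset.sum_nonneg fun y _ =>
    mul_nonneg (mul_nonneg (hμ.1 x) (hμ.1 y)) (K.M_nonneg hp0 hp1 x y)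

theorem g_pos (K : CRG) {p : ℝ} (hp0 : 0 < p) (hp1 : p < 1) : 0 < K.g p := by
  obtain ⟨μ, hμ, h⟩ := K.exists_sum_eq_g p
  obtain ⟨x, hx⟩ : ∃ x, μ x ≠ 0 := by
    by_contra! hall
    have := hμ.2
    simp [hall] at this
  have hx' : 0 < μ x := lt_of_le_of_ne (hμ.1 x) hx.symm
  have hn : ∀ x y, 0 ≤ μ x * μ y * K.M p x y := fun x y =>
    mul_nonneg (mul_nonneg (hμ.1 x) (hμ.1 y)) (K.M_nonneg hp0.le hp1.le x y)
  rw [← h]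
  refine Finset.sum_pos' (fun x _ => Finset.sum_nonneg fun y _ => hn x y)
    ⟨x, Finset.mem_univ _, ?_⟩
  refine Finset.sum_pos' (fun y _ => hn x y) ⟨x, Finset.mem_univ _, ?_⟩
  refine mul_pos (mul_pos hx' hx') ?_
  rw [M_apply_self]
  cases K.vcol x <;> simp [VColor.weight] <;> linarith

theorem g_le_one (K : CRG) {p : ℝ} (hp0 : 0 ≤ p) (hp1 : p ≤ 1) : K.g p ≤ 1 := by
  have h : (fun _ : Unit => (1 : ℝ)) ∈ stdSimplex ℝ Unit := ⟨fun _ => zero_le_one, by simp⟩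
  refine (K.g_le_sum p h fun _ => Classical.arbitrary K.V).trans ?_
  simpa using K.M_le_one hp0 hp1 _ _

/-- `g_K` is `1`-Lipschitz. -/
theorem g_le_add_abs (K : CRG) (p q : ℝ) : K.g p ≤ K.g q + |p - q| := by
  obtain ⟨μ, hμ, h⟩ := K.exists_sum_eq_g q
  refine (K.g_le_sum p hμ id).trans ?_
  have h1 : ∑ x, ∑ y, μ x * μ y * |p - q| = |p - q| := by
    simp only [← Finset.sum_mul, ← Finset.mul_sum, hμ.2, one_mul, mul_one]
  rw [← h, ← h1, ← Finset.sum_add_distrib]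
  refine Finset.sum_le_sum fun x _ => ?_
  rw [← Finset.sum_add_distrib]
  refine Finset.sum_le_sum fun y _ => ?_
  rw [← mul_add]
  refine mul_le_mul_of_nonneg_left ?_ (mul_nonneg (hμ.1 x) (hμ.1 y))
  have h2 := (le_abs_self _).trans (K.abs_M_sub_le p q x y)
  simp only [id]
  linarith

/-- An injection of vertices that preserves the colours of vertices and edges, that is, an
isomorphism of `L` onto a sub-CRG of `K`. -/
def IsEmb {L K : CRG} (e : L.V ↪ K.V) : Prop :=
  (∀ x, K.vcol (e x) = L.vcol x) ∧ ∀ x y, x ≠ y → K.ecol (e x) (e y) = L.ecol x y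

namespace IsEmb

variable {J L K : CRG}

theorem trans {e : J.V ↪ L.V} {f : L.V ↪ K.V} (he : IsEmb e) (hf : IsEmb f) :
    IsEmb (e.trans f) :=
  ⟨fun x => (hf.1 _).trans (he.1 x), fun x y h =>
    (hf.2 _ _ (e.injective.ne h)).trans (he.2 x y h)⟩

theorem M_eq {e : L.V ↪ K.V} (he : IsEmb e) (p : ℝ) (x y : L.V) :
    K.M p (e x) (e y) = L.M p x y := by
  by_cases h : x = y
  · rw [h, M_apply_self, M_apply_self, he.1]
  · rw [M_apply_ne _ _ h, M_apply_ne _ _ (e.injective.ne h), he.2 x y h]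

theorem g_le {e : L.V ↪ K.V} (he : IsEmb e) (p : ℝ) : K.g p ≤ L.g p := by
  obtain ⟨μ, hμ, h⟩ := L.exists_sum_eq_g p
  refine (K.g_le_sum p hμ e).trans_eq ?_
  simp only [he.M_eq, h]

theorem isZeroCore {e : L.V ↪ K.V} (he : IsEmb e) (hK : K.IsZeroCore) : L.IsZeroCore := by
  intro x y hxy
  simpa only [he.1, he.2 x y hxy] using hK _ _ (e.injective.ne hxy)

end IsEmb

theorem mem_VW {K : CRG} {x : K.V} : x ∈ K.VW ↔ K.vcol x = VColor.white := by
  simp [VW]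

theorem notMem_VW {K : CRG} {x : K.V} : x ∉ K.VW ↔ K.vcol x = VColor.black := by
  rw [mem_VW]
  cases K.vcol x <;> simp

theorem IsEmb.map_subset_VW {L K : CRG} {e : L.V ↪ K.V} (he : IsEmb e) {S : Finset L.V}
    (hS : S ⊆ L.VW) : S.map e ⊆ K.VW := by
  intro y hy
  obtain ⟨x, hx, rfl⟩ := Finset.mem_map.1 hy
  rw [mem_VW, he.1, ← mem_VW]
  exact hS hx

/-- If an embedding reaches all white vertices, then the numbers of white vertices agree. -/
theorem IsEmb.card_VW_eq {L K : CRG} {e : L.V ↪ K.V} (he : IsEmb e)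
    (h : ∀ x ∈ K.VW, x ∈ Set.range e) : L.VW.card = K.VW.card := by
  rw [← Finset.card_map e]
  congr 1
  refine Finset.Subset.antisymm (he.map_subset_VW (Finset.Subset.refl _)) fun y hy => ?_
  obtain ⟨x, rfl⟩ := h y hy
  refine Finset.mem_map.2 ⟨x, ?_, rfl⟩
  rw [mem_VW, he.1] at hy
  exact mem_VW.2 hy

theorem Iso.exists_isEmb {L K : CRG} (h : L.Iso K) :
    ∃ e : L.V ↪ K.V, IsEmb e ∧ Function.Surjective e := by
  obtain ⟨e, h1, h2⟩ := h
  exact ⟨e.toEmbedding, ⟨h1, h2⟩, e.surjective⟩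

theorem Iso.symm {L K : CRG} (h : L.Iso K) : K.Iso L := by
  obtain ⟨e, h1, h2⟩ := h
  refine ⟨e.symm, fun x => ?_, fun x y hxy => ?_⟩
  · rw [← h1, e.apply_symm_apply]
  · rw [← h2 _ _ (e.symm.injective.ne hxy), e.apply_symm_apply, e.apply_symm_apply]

theorem isEmb_induce (K : CRG) (s : Set K.V) (hs : s.Nonempty) :
    IsEmb (L := K.induce s hs) (K := K) (Function.Embedding.subtype s) :=
  ⟨fun _ => rfl, fun _ _ _ => rfl⟩

theorem g_induce_le_sum (K : CRG) (p : ℝ) (s : Set K.V) (hs : s.Nonempty) {ι : Type*} [Fintype ι]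
    {μ : ι → ℝ} (hμ : μ ∈ stdSimplex ℝ ι) (f : ι → K.V) (hf : ∀ i, f i ∈ s) :
    (K.induce s hs).g p ≤ ∑ i, ∑ j, μ i * μ j * K.M p (f i) (f j) := by
  refine ((K.induce s hs).g_le_sum p hμ fun i => (⟨f i, hf i⟩ : s)).trans_eq ?_
  refine Finset.sum_congr rfl fun i _ => Finset.sum_congr rfl fun j _ => ?_
  exact congrArg (μ i * μ j * ·)
    ((K.isEmb_induce s hs).M_eq p (⟨f i, hf i⟩ : s) (⟨f j, hf j⟩ : s)).symm

/-! ### Optimal weights of core CRGs -/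

theorem isCore_iff {K : CRG} {p : ℝ} (hp0 : 0 < p) (hp1 : p < 1) :
    K.IsCore p ↔ ∀ (s : Set K.V) (hs : s.Nonempty), s ≠ Set.univ → K.g p < (K.induce s hs).g p := by
  simp [IsCore, hp0.ne', hp1.ne, hp0, hp1]

/-- A core CRG has no mass of value at most `g` that misses a vertex. -/
theorem IsCore.surjective_of_sum_le {K : CRG} {p : ℝ} (hK : K.IsCore p) (hp0 : 0 < p) (hp1 : p < 1)
    {ι : Type*} [Fintype ι] {μ : ι → ℝ} (hμ : μ ∈ stdSimplex ℝ ι) (f : ι → K.V)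
    (h : ∑ i, ∑ j, μ i * μ j * K.M p (f i) (f j) ≤ K.g p) : Function.Surjective f := by
  by_contra hf
  rw [← Set.range_eq_univ] at hf
  have hs : (Set.range f).Nonempty := by
    have : Nonempty ι := by
      by_contra hι
      rw [not_nonempty_iff] at hι
      have := hμ.2
      simp at this
    exact Set.range_nonempty f
  exact absurd ((K.g_induce_le_sum p _ hs hμ f fun i => ⟨i, rfl⟩).trans h)
    (not_le.2 ((isCore_iff hp0 hp1).1 hK _ hs hf))

/-- The optimal mass of a core CRG has full support and satisfies `M μ = g`. -/
theorem IsCore.exists_optimal {K : CRG} {p : ℝ} (hK : K.IsCore p) (hp0 : 0 < p) (hp1 : p < 1) :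
    ∃ μ ∈ stdSimplex ℝ K.V, (∀ x, 0 < μ x) ∧ ∀ x, ∑ y, μ y * K.M p x y = K.g p := by
  classical
  obtain ⟨μ, hμ, h⟩ := K.exists_sum_eq_g p
  have hpos : ∀ x, 0 < μ x := by
    intro x
    refine lt_of_le_of_ne (hμ.1 x) fun hx => ?_
    obtain ⟨y, hy⟩ : ∃ y, μ y ≠ 0 := by
      by_contra! hall
      have := hμ.2
      simp [hall] at this
    have hxy : y ≠ x := by rintro rfl; exact hy hx.symm
    -- the vertex `x` carries no mass, so that it can be sent to `y`
    have hs := hK.surjective_of_sum_le hp0 hp1 hμ (fun z => if z = x then y else z) (by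
      rw [← h]
      refine (Finset.sum_congr rfl fun u _ => Finset.sum_congr rfl fun v _ => ?_).le
      by_cases hu : u = x
      · simp [hu, ← hx]
      by_cases hv : v = x
      · simp [hv, ← hx]
      simp [hu, hv])
    obtain ⟨z, hz⟩ := hs x
    dsimp only at hz
    split_ifs at hz with h1
    exacts [hxy hz, h1 hz]
  refine ⟨μ, hμ, hpos, ?_⟩
  set r : K.V → ℝ := fun x => ∑ y, μ y * K.M p x y with hr
  have hsum : ∑ x, μ x * r x = K.g p := by
    rw [← h]
    simp only [hr, Finset.mul_sum, mul_assoc]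
  have hge : ∀ x, K.g p ≤ r x := by
    intro x
    by_contra! hlt
    have hval : ∀ t : ℝ, 0 ≤ t → t ≤ 1 →
        K.g p ≤ (1 - t) ^ 2 * K.g p + 2 * t * (1 - t) * r x + t ^ 2 * K.M p x x := by
      intro t ht0 ht1
      have hmem : (fun o : Option K.V => o.elim t fun y => (1 - t) * μ y) ∈
          stdSimplex ℝ (Option K.V) := by
        refine ⟨fun o => ?_, ?_⟩
        · cases o with
          | none => exact ht0
          | some y => exact mul_nonneg (by linarith) (hμ.1 y)
        · simp [Fintype.sum_option, ← Finset.mul_sum, hμ.2]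
      refine (K.g_le_sum p hmem fun o => o.elim x id).trans_eq ?_
      have e1 : ∑ y, t * ((1 - t) * μ y) * K.M p x y = t * (1 - t) * r x := by
        rw [hr, Finset.mul_sum]
        exact Finset.sum_congr rfl fun y _ => by ring
      have e2 : ∑ y, (1 - t) * μ y * t * K.M p y x = t * (1 - t) * r x := by
        rw [hr, Finset.mul_sum]
        exact Finset.sum_congr rfl fun y _ => by rw [K.M_comm]; ring
      have e3 : ∑ y, ∑ z, (1 - t) * μ y * ((1 - t) * μ z) * K.M p y z = (1 - t) ^ 2 * K.g p := by
        rw [← h, Finset.mul_sum]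
        refine Finset.sum_congr rfl fun y _ => ?_
        rw [Finset.mul_sum]
        exact Finset.sum_congr rfl fun z _ => by ring
      simp only [Fintype.sum_option, Option.elim_none, Option.elim_some, id,
        Finset.sum_add_distrib, e1, e2, e3]
      ring
    -- moving a small mass `t` to `x` gains `2 t (g - r x)`, up to a term of order `t ^ 2`
    set δ := K.g p - r x with hδ
    have hδ0 : 0 < δ := by rw [hδ]; linarith
    have hr0 : 0 ≤ r x := Finset.sum_nonneg fun y _ =>
      mul_nonneg (hμ.1 y) (K.M_nonneg hp0.le hp1.le x y)
    have hδ1 : δ ≤ 1 := by linarith [K.g_le_one hp0.le hp1.le]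
    have hv := hval (δ / 2) (by linarith) (by linarith)
    have hM := K.M_le_one hp0.le hp1.le x x
    have hg := K.g_le_one hp0.le hp1.le
    have : r x = K.g p - δ := by rw [hδ]; ring
    rw [this] at hv
    nlinarith [mul_pos hδ0 hδ0, mul_pos hδ0 (mul_pos hδ0 hδ0),
      mul_nonneg (mul_pos hδ0 hδ0).le (sub_nonneg.2 hM)]
  have hz : ∑ x, μ x * (r x - K.g p) = 0 := by
    simp only [mul_sub, Finset.sum_sub_distrib, hsum, ← Finset.sum_mul, hμ.2]
    ring
  intro x
  have := (Finset.sum_eq_zero_iff_of_nonneg fun x _ =>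
    mul_nonneg (hμ.1 x) (sub_nonneg.2 (hge x))).1 hz x (Finset.mem_univ _)
  rcases mul_eq_zero.1 this with h0 | h0
  · exact absurd h0 (hpos x).ne'
  · exact sub_eq_zero.1 h0

/-! ### Whitening a vertex and the structure of core CRGs -/

open Classical in
/-- The CRG obtained from `K` by making the vertex `x` white and all edges at `x` gray.
It is reducible, so that its vertices are seen to be those of `K`. -/
noncomputable abbrev whiten (K : CRG) (x : K.V) : CRG where
  V := K.V
  vcol y := if y = x then VColor.white else K.vcol y
  ecol y z := if y = x ∨ z = x then EColor.gray else K.ecol y z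
  ecol_symm y z := by simp only [or_comm (a := y = x), K.ecol_symm y]

open Classical in
/-- The map that fixes the gray neighbours of `x` and sends all other vertices to `x`. -/
noncomputable def collapse (K : CRG) (x y : K.V) : K.V :=
  if y ≠ x ∧ K.ecol x y = EColor.gray then y else x

theorem collapse_eq_self_or (K : CRG) (x y : K.V) :
    K.collapse x y = x ∨
      (K.collapse x y = y ∧ y ≠ x ∧ K.ecol x y = EColor.gray) := by
  unfold collapse
  split_ifs with h
  exacts [Or.inr ⟨rfl, h⟩, Or.inl rfl]

theorem M_whiten_self (K : CRG) (x : K.V) (p : ℝ) : (K.whiten x).M p x x = p := by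
  rw [M_apply_self]
  simp [VColor.weight]

theorem M_whiten_left (K : CRG) {x y : K.V} (h : y ≠ x) (p : ℝ) : (K.whiten x).M p x y = 0 := by
  rw [M_apply_ne (K.whiten x) p (Ne.symm h)]
  simp [EColor.weight]

theorem M_whiten_of_ne (K : CRG) {x y z : K.V} (hy : y ≠ x) (hz : z ≠ x) (p : ℝ) :
    (K.whiten x).M p y z = K.M p y z := by
  by_cases h : y = z
  · subst h
    rw [M_apply_self, M_apply_self]
    simp [hy]
  · rw [M_apply_ne (K.whiten x) p h, M_apply_ne K p h]
    simp [hy, hz]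

/-- Zykov symmetrization: if `M μ = g`, then whitening `x` and moving onto `x` the mass of all
vertices that are not gray neighbours of `x` does not increase the value. -/
theorem sum_whiten_collapse_le (K : CRG) {p : ℝ} (hp0 : 0 ≤ p) (hp1 : p ≤ 1 / 2) {μ : K.V → ℝ}
    (hμ : μ ∈ stdSimplex ℝ K.V) (hopt : ∀ x, ∑ y, μ y * K.M p x y = K.g p) (x : K.V) :
    ∑ u, ∑ v, μ u * μ v * (K.whiten x).M p (K.collapse x u) (K.collapse x v) ≤ K.g p := by
  classical
  -- `a` is the mass that is moved to `x`
  set c : K.V → ℝ := fun u => if u ≠ x ∧ K.ecol x u = EColor.gray then 0 else 1 with hc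
  set a : ℝ := ∑ u, μ u * c u with ha
  have hc01 : ∀ u, c u = 0 ∨ c u = 1 := fun u => by
    simp only [hc]
    split_ifs <;> simp
  have ha0 : 0 ≤ a := Finset.sum_nonneg fun u _ => mul_nonneg (hμ.1 u) (by
    rcases hc01 u with h | h <;> rw [h]
    exact zero_le_one)
  -- every vertex that is moved has an entry of at least `p` in the row of `x`
  have hpa : p * a ≤ K.g p := by
    rw [← hopt x, ha, Finset.mul_sum]
    refine Finset.sum_le_sum fun u _ => ?_
    rw [← mul_assoc, mul_comm p, mul_assoc]
    refine mul_le_mul_of_nonneg_left ?_ (hμ.1 u)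
    simp only [hc]
    split_ifs with h
    · simpa using K.M_nonneg hp0 (by linarith) x u
    · by_cases hu : x = u
      · subst hu
        rw [M_apply_self]
        cases K.vcol x <;> simp [VColor.weight] <;> linarith
      · rw [M_apply_ne _ _ hu]
        have : K.ecol x u ≠ EColor.gray := fun h' => h ⟨Ne.symm hu, h'⟩
        cases h2 : K.ecol x u <;> simp [EColor.weight, h2] at this ⊢ <;> linarith
  have hterm : ∀ u v, (K.whiten x).M p (K.collapse x u) (K.collapse x v) ≤
      (1 - c u) * K.M p u v + p * (c u * c v) := by
    intro u v
    by_cases hu : u ≠ x ∧ K.ecol x u = EColor.gray <;>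
      by_cases hv : v ≠ x ∧ K.ecol x v = EColor.gray
    · simp [collapse, hu, hv, hc, K.M_whiten_of_ne hu.1 hv.1]
    · simp only [collapse, if_pos hu, if_neg hv, hc]
      rw [M_comm (K.whiten x), K.M_whiten_left hu.1]
      have := K.M_nonneg hp0 (by linarith) u v
      simpa using this
    · simp only [collapse, if_neg hu, if_pos hv, hc]
      rw [K.M_whiten_left hv.1]
      simp
    · simp only [collapse, if_neg hu, if_neg hv, hc]
      rw [K.M_whiten_self]
      simp
  calc ∑ u, ∑ v, μ u * μ v * (K.whiten x).M p (K.collapse x u) (K.collapse x v)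
      ≤ ∑ u, ∑ v, μ u * μ v * ((1 - c u) * K.M p u v + p * (c u * c v)) :=
        Finset.sum_le_sum fun u _ => Finset.sum_le_sum fun v _ =>
          mul_le_mul_of_nonneg_left (hterm u v) (mul_nonneg (hμ.1 u) (hμ.1 v))
    _ = ∑ u, μ u * ((1 - c u) * K.g p + p * c u * a) := by
        refine Finset.sum_congr rfl fun u _ => ?_
        rw [← hopt u, ha, Finset.mul_sum, Finset.mul_sum, ← Finset.sum_add_distrib, Finset.mul_sum]
        exact Finset.sum_congr rfl fun v _ => by ring
    _ = ∑ u, (μ u * K.g p + μ u * c u * (p * a - K.g p)) :=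
        Finset.sum_congr rfl fun u _ => by ring
    _ = K.g p + a * (p * a - K.g p) := by
        rw [Finset.sum_add_distrib, ← Finset.sum_mul, ← Finset.sum_mul, hμ.2, one_mul]
    _ ≤ K.g p := by nlinarith

/-- A white vertex of a core CRG sends only gray edges: otherwise symmetrization at this vertex
frees another vertex of its mass. -/
theorem IsCore.ecol_eq_gray_of_white {K : CRG} {p : ℝ} (hK : K.IsCore p) (hp0 : 0 < p)
    (hp1 : p < 1 / 2) {x y : K.V} (hx : K.vcol x = VColor.white) (hxy : x ≠ y) :
    K.ecol x y = EColor.gray := by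
  obtain ⟨μ, hμ, -, hopt⟩ := hK.exists_optimal hp0 (by linarith)
  have hle := K.sum_whiten_collapse_le hp0.le hp1.le hμ hopt x
  have hM : ∀ u v, (K.whiten x).M p (K.collapse x u) (K.collapse x v) =
      K.M p (K.collapse x u) (K.collapse x v) := by
    have h1 : ∀ v, (K.whiten x).M p x (K.collapse x v) = K.M p x (K.collapse x v) := by
      intro v
      rcases K.collapse_eq_self_or x v with h | ⟨h, hv, hg⟩
      · rw [h, M_whiten_self, M_apply_self, hx, VColor.weight]
      · rw [h, K.M_whiten_left hv, M_apply_ne _ _ hv.symm, hg, EColor.weight]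
    intro u v
    rcases K.collapse_eq_self_or x u with hu | ⟨hu, hu', -⟩
    · rw [hu, h1]
    rcases K.collapse_eq_self_or x v with hv | ⟨hv, hv', -⟩
    · rw [hv, M_comm (K.whiten x), h1, M_comm]
    · rw [hu, hv, K.M_whiten_of_ne hu' hv']
  simp only [hM] at hle
  obtain ⟨z, hz⟩ := hK.surjective_of_sum_le hp0 (by linarith) hμ _ hle y
  rcases K.collapse_eq_self_or x z with h | ⟨h, -, hg⟩
  · exact absurd (h.symm.trans hz) hxy
  · rwa [← hz, h]

/-- There is no black edge between two black vertices of a core CRG: otherwise the mass of one end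
can be moved to the other without a change of the value. -/
theorem IsCore.ecol_ne_black {K : CRG} {p : ℝ} (hK : K.IsCore p) (hp0 : 0 < p)
    (hp1 : p < 1) {x y : K.V} (hx : K.vcol x = VColor.black) (hy : K.vcol y = VColor.black)
    (hxy : x ≠ y) : K.ecol x y ≠ EColor.black := by
  classical
  intro he
  obtain ⟨μ, hμ, -, hopt⟩ := hK.exists_optimal hp0 hp1
  set f : K.V → K.V := fun z => if z = y then x else z with hf
  have hshift : ∀ k : K.V → ℝ, ∑ v, μ v * k (f v) = ∑ v, μ v * k v + μ y * (k x - k y) := by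
    intro k
    have : ∀ v, μ v * k (f v) = μ v * k v + if v = y then μ y * (k x - k y) else 0 := by
      intro v
      by_cases hv : v = y
      · simp only [hf, hv, if_true]; ring
      · simp [hf, hv]
    simp [this, Finset.sum_add_distrib]
  have hsum : ∑ u, ∑ v, μ u * μ v * K.M p (f u) (f v) = K.g p := by
    simp only [mul_assoc, ← Finset.mul_sum]
    have h0 : ∀ u, ∑ v, μ v * K.M p u (f v) = K.g p + μ y * (K.M p u x - K.M p u y) := fun u => by
      rw [hshift fun v => K.M p u v, hopt]
    simp only [h0]
    rw [hshift fun u => K.g p + μ y * (K.M p u x - K.M p u y)]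
    have h1 : ∑ u, μ u * (K.M p u x - K.M p u y) = 0 := by
      simp only [mul_sub, Finset.sum_sub_distrib, K.M_comm p _ x, K.M_comm p _ y, hopt, sub_self]
    have h2 : ∀ u, μ u * (K.g p + μ y * (K.M p u x - K.M p u y)) =
        μ u * K.g p + μ y * (μ u * (K.M p u x - K.M p u y)) := fun u => by ring
    simp only [h2, Finset.sum_add_distrib, ← Finset.sum_mul, ← Finset.mul_sum, h1, hμ.2]
    have exx : K.M p x x = 1 - p := by rw [M_apply_self, hx, VColor.weight]
    have eyy : K.M p y y = 1 - p := by rw [M_apply_self, hy, VColor.weight]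
    have exy : K.M p x y = 1 - p := by rw [M_apply_ne _ _ hxy, he, EColor.weight]
    rw [K.M_comm p y x, exx, eyy, exy]
    ring
  obtain ⟨z, hz⟩ := hK.surjective_of_sum_le hp0 hp1 hμ f hsum.le y
  simp only [hf] at hz
  split_ifs at hz with h
  exacts [hxy hz, h hz]

theorem IsCore.isZeroCore {K : CRG} {p : ℝ} (hK : K.IsCore p) (hp0 : 0 < p) (hp1 : p < 1 / 2) :
    K.IsZeroCore := by
  intro x y hxy
  cases hx : K.vcol x with
  | white => exact Or.inl (hK.ecol_eq_gray_of_white hp0 hp1 hx hxy)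
  | black =>
    cases hy : K.vcol y with
    | white =>
      rw [K.ecol_symm]
      exact Or.inl (hK.ecol_eq_gray_of_white hp0 hp1 hy hxy.symm)
    | black =>
      have := hK.ecol_ne_black hp0 (by linarith) hx hy hxy
      cases h : K.ecol x y <;> simp_all

theorem IsZeroCore.ecol_eq_gray {K : CRG} (hK : K.IsZeroCore) {x y : K.V} (hx : x ∈ K.VW)
    (hxy : x ≠ y) : K.ecol x y = EColor.gray := by
  rcases hK x y hxy with h | ⟨-, h, -⟩
  · exact h
  · exact absurd hx (notMem_VW.2 h)

theorem IsZeroCore.whiten {K : CRG} (hK : K.IsZeroCore) (x : K.V) : (K.whiten x).IsZeroCore := by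
  intro y z hyz
  by_cases hy : y = x
  · exact Or.inl (if_pos (Or.inl hy))
  by_cases hz : z = x
  · exact Or.inl (if_pos (Or.inr hz))
  have h := hK y z hyz
  simp only [hy, hz, or_self, if_false]
  exact h

/-! ### Core sub-CRGs -/

theorem exists_isEmb_isCore {p : ℝ} (hp0 : 0 < p) (hp1 : p < 1) (K : CRG) :
    ∃ (L : CRG) (e : L.V ↪ K.V), IsEmb e ∧ L.IsCore p ∧ L.g p ≤ K.g p := by
  induction h : Fintype.card K.V using Nat.strong_induction_on generalizing K with
  | _ n ih =>
    by_cases hK : K.IsCore p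
    · exact ⟨K, Function.Embedding.refl _, ⟨fun _ => rfl, fun _ _ _ => rfl⟩, hK, le_rfl⟩
    · rw [isCore_iff hp0 hp1] at hK
      push Not at hK
      obtain ⟨s, hs, hne, hg⟩ := hK
      have hcard : Fintype.card (K.induce s hs).V < n := by
        rw [← h, ← Nat.card_eq_fintype_card, ← Nat.card_eq_fintype_card]
        exact (Set.ncard_lt_ncard (Set.ssubset_univ_iff.2 hne)).trans_eq (Set.ncard_univ _)
      obtain ⟨L, e, he, hL, hLg⟩ := ih _ hcard (K.induce s hs) rfl
      exact ⟨L, _, he.trans (K.isEmb_induce s hs), hL, hLg.trans hg⟩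

/-- A sub-CRG of a zero-core CRG `K` whose value does not exceed that of `K` contains all white
vertices of `K`: adding a white vertex, joined to everything by gray edges, lowers the value. -/
theorem IsEmb.mem_range_of_mem_VW {L K : CRG} {e : L.V ↪ K.V} (he : IsEmb e) (hK : K.IsZeroCore)
    {p : ℝ} (hp0 : 0 < p) (hp1 : p < 1) (hg : L.g p ≤ K.g p) {x : K.V} (hx : x ∈ K.VW) :
    x ∈ Set.range e := by
  by_contra hxe
  have hne : ∀ y, x ≠ e y := fun y h => hxe ⟨y, h.symm⟩
  obtain ⟨μ, hμ, h⟩ := L.exists_sum_eq_g p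
  have hgp := L.g_pos hp0 hp1
  -- the mass `t` of the new vertex minimizes `(1 - t) ^ 2 * g + t ^ 2 * p`
  set t := L.g p / (L.g p + p) with ht
  have ht0 : 0 ≤ t := by positivity
  have ht1 : t ≤ 1 := by rw [ht, div_le_one (by positivity)]; linarith
  have hmem : (fun o : Option L.V => o.elim t fun y => (1 - t) * μ y) ∈
      stdSimplex ℝ (Option L.V) := by
    refine ⟨fun o => ?_, ?_⟩
    · cases o with
      | none => exact ht0
      | some y => exact mul_nonneg (by linarith) (hμ.1 y)
    · simp [Fintype.sum_option, ← Finset.mul_sum, hμ.2]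
  have hle := K.g_le_sum p hmem fun o => o.elim x e
  have e0 : ∀ y, K.M p x (e y) = 0 := fun y => by
    rw [M_apply_ne _ _ (hne y), hK.ecol_eq_gray hx (hne y), EColor.weight]
  have e1 : ∀ y, K.M p (e y) x = 0 := fun y => by rw [M_comm, e0]
  have e2 : K.M p x x = p := by rw [M_apply_self, mem_VW.1 hx, VColor.weight]
  have e3 : ∑ y, ∑ z, (1 - t) * μ y * ((1 - t) * μ z) * L.M p y z = (1 - t) ^ 2 * L.g p := by
    rw [← h, Finset.mul_sum]
    refine Finset.sum_congr rfl fun y _ => ?_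
    rw [Finset.mul_sum]
    exact Finset.sum_congr rfl fun z _ => by ring
  simp only [Fintype.sum_option, Option.elim_none, Option.elim_some, e0, e1, e2, he.M_eq, mul_zero,
    Finset.sum_const_zero, add_zero, zero_add, e3] at hle
  have hval : t * t * p + (1 - t) ^ 2 * L.g p = L.g p * (p / (L.g p + p)) := by
    rw [ht]
    field_simp
    ring
  have hlt : p / (L.g p + p) < 1 := by rw [div_lt_one (by positivity)]; linarith
  have := mul_lt_mul_of_pos_left hlt hgp
  linarith

end CRG

/-! ### Cluster maps -/

/-- `F.ClusterMapsTo K S` says that `F` maps to the CRG obtained from the zero-core CRG `K` by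
replacing the vertices in `S` by dalmatian CRGs of sufficiently large size.  The fibre over a vertex
in `S` has to be a disjoint union of cliques, that is, adjacency has to be transitive on it. -/
def FinGraph.ClusterMapsTo (F : FinGraph) (K : CRG) (S : Finset K.V) : Prop :=
  ∃ φ : F.V → K.V,
    (∀ u v, F.graph.Adj u v → φ u ≠ φ v → K.ecol (φ u) (φ v) = EColor.gray) ∧
    (∀ u v, u ≠ v → φ u = φ v → φ u ∉ S →
      (F.graph.Adj u v ↔ K.vcol (φ u) = VColor.black)) ∧
    (∀ u v z, φ u = φ v → φ v = φ z → φ u ∈ S → F.graph.Adj u v → F.graph.Adj v z → u ≠ z →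
      F.graph.Adj u z)

namespace FinGraph.ClusterMapsTo

open CRG

variable {F : FinGraph} {K : CRG}

theorem map {L : CRG} {e : L.V ↪ K.V} (he : IsEmb e) {S : Finset L.V}
    (h : F.ClusterMapsTo L S) : F.ClusterMapsTo K (S.map e) := by
  obtain ⟨φ, h1, h2, h3⟩ := h
  refine ⟨fun u => e (φ u), fun u v huv hne => ?_, fun u v huv heq hS => ?_,
    fun u v z huv hvz hS => ?_⟩
  · have hne' : φ u ≠ φ v := fun h => hne (congrArg e h)
    rw [he.2 _ _ hne']
    exact h1 u v huv hne'
  · rw [he.1]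
    exact h2 u v huv (e.injective heq) fun h => hS (Finset.mem_map_of_mem e h)
  · exact h3 u v z (e.injective huv) (e.injective hvz) (by simpa using hS)

theorem mono {S T : Finset K.V} (hST : S ⊆ T) (h : F.ClusterMapsTo K S)
    (hT : T ⊆ K.VW) : F.ClusterMapsTo K T := by
  obtain ⟨φ, h1, h2, h3⟩ := h
  refine ⟨φ, h1, fun u v huv heq hn => h2 u v huv heq fun h => hn (hST h), ?_⟩
  intro u v z huv hvz hu ha hb hne
  by_cases hu' : φ u ∈ S
  · exact h3 u v z huv hvz hu' ha hb hne
  · have := (h2 u v ha.ne huv hu').1 ha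
    exact absurd (hT hu) (notMem_VW.2 this)

/-- The trivial cluster map: all vertices of `F` go to distinct white vertices. -/
theorem of_card_le (hK : K.IsZeroCore) (h : Fintype.card F.V ≤ K.VW.card) (S : Finset K.V) :
    F.ClusterMapsTo K S := by
  rw [← Fintype.card_coe] at h
  obtain ⟨e⟩ := Function.Embedding.nonempty_of_card_le h
  refine ⟨fun u => e u, fun u v _ hne => hK.ecol_eq_gray (e u).2 hne, fun u v hne heq => ?_,
    fun u v z huv hvz _ _ _ hne => ?_⟩
  · exact absurd (e.injective (Subtype.ext heq)) hne
  · exact absurd (e.injective (Subtype.ext (huv.trans hvz))) hne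

theorem mapsTo (hK : K.IsZeroCore) (h : F.ClusterMapsTo K ∅) : F.MapsTo K := by
  obtain ⟨φ, h1, h2, -⟩ := h
  refine ⟨φ, fun u v huv => ?_, fun u v hne huv => ?_⟩
  · by_cases heq : φ u = φ v
    · exact Or.inl ⟨heq, (h2 u v huv.ne heq (by simp)).1 huv⟩
    · exact Or.inr ⟨heq, Or.inr (h1 u v huv heq)⟩
  · by_cases heq : φ u = φ v
    · refine Or.inl ⟨heq, ?_⟩
      rw [← mem_VW]
      by_contra hw
      exact huv ((h2 u v hne heq (by simp)).2 (notMem_VW.1 hw))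
    · refine Or.inr ⟨heq, ?_⟩
      rcases hK _ _ heq with h | ⟨h, -⟩
      exacts [Or.inr h, Or.inl h]

theorem of_mapsTo (hK : K.IsZeroCore) (h : F.MapsTo K) : F.ClusterMapsTo K ∅ := by
  obtain ⟨φ, h1, h2⟩ := h
  refine ⟨φ, fun u v huv hne => ?_, fun u v hne heq _ => ⟨fun huv => ?_, fun hb => ?_⟩, ?_⟩
  · rcases hK _ _ hne with h | ⟨h, -⟩
    · exact h
    · rcases h1 u v huv with ⟨h', -⟩ | ⟨-, h' | h'⟩
      · exact absurd h' hne
      · simp [h] at h'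
      · exact h'
  · rcases h1 u v huv with ⟨-, h'⟩ | ⟨h', -⟩
    exacts [h', absurd heq h']
  · by_contra huv
    rcases h2 u v hne huv with ⟨-, h'⟩ | ⟨h', -⟩
    · simp [hb] at h'
    · exact h' heq
  · simp

theorem of_mapsTo_dalmatian (hK : K.IsZeroCore) {S : Finset K.V} {ℓ : ℕ} {hℓ : 1 ≤ ℓ}
    (h : F.MapsTo (K.dalmatian S ℓ hℓ)) : F.ClusterMapsTo K S := by
  obtain ⟨φ, h1, h2⟩ := h
  have he : ∀ a b, K.dalmatianBase S ℓ a = K.dalmatianBase S ℓ b →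
      (K.dalmatian S ℓ hℓ).ecol a b = EColor.white := fun a b hab => if_pos hab
  have hn : ∀ a b, K.dalmatianBase S ℓ a ≠ K.dalmatianBase S ℓ b →
      (K.dalmatian S ℓ hℓ).ecol a b = K.ecol (K.dalmatianBase S ℓ a) (K.dalmatianBase S ℓ b) :=
    fun a b hab => if_neg hab
  have hout : ∀ a, K.dalmatianBase S ℓ a ∉ S →
      (K.dalmatian S ℓ hℓ).vcol a = K.vcol (K.dalmatianBase S ℓ a) := by
    rintro (a | a) ha
    · rfl
    · exact absurd a.1.2 ha
  have hin : ∀ a, K.dalmatianBase S ℓ a ∈ S → (K.dalmatian S ℓ hℓ).vcol a = VColor.black := by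
    rintro (a | a) ha
    · exact absurd ha a.2
    · rfl
  have hinj : ∀ a b, K.dalmatianBase S ℓ a = K.dalmatianBase S ℓ b →
      K.dalmatianBase S ℓ a ∉ S → a = b := by
    rintro (a | a) (b | b) hab ha
    · exact congrArg Sum.inl (Subtype.ext hab)
    · exact absurd (hab ▸ b.1.2 : K.dalmatianBase S ℓ (Sum.inl a) ∈ S) ha
    · exact absurd a.1.2 ha
    · exact absurd a.1.2 ha
  refine ⟨fun u => K.dalmatianBase S ℓ (φ u), fun u v huv hne => ?_,
    fun u v hne heq hS => ⟨fun huv => ?_, fun hb => ?_⟩, fun u v z huv hvz hS ha hb hne => ?_⟩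
  · have hne' : φ u ≠ φ v := fun h => hne (congrArg _ h)
    rcases h1 u v huv with ⟨h', -⟩ | ⟨-, h'⟩
    · exact absurd h' hne'
    · rw [hn _ _ hne] at h'
      rcases hK _ _ hne with h | ⟨h, -⟩
      · exact h
      · simp [h] at h'
  · rw [← hout _ hS]
    rcases h1 u v huv with ⟨-, h'⟩ | ⟨h', -⟩
    exacts [h', absurd (hinj _ _ heq hS) h']
  · rw [← hout _ hS] at hb
    by_contra huv
    rcases h2 u v hne huv with ⟨-, h'⟩ | ⟨h', -⟩
    · rw [hb] at h'
      exact absurd h' (by simp)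
    · exact h' (hinj _ _ heq hS)
  · -- adjacent vertices in a fibre over `S` go to the same black vertex
    have hsame : ∀ u v, K.dalmatianBase S ℓ (φ u) = K.dalmatianBase S ℓ (φ v) →
        F.graph.Adj u v → φ u = φ v := by
      intro u v huv hadj
      rcases h1 u v hadj with ⟨h', -⟩ | ⟨-, h'⟩
      · exact h'
      · rw [he _ _ huv] at h'
        simp at h'
    have huz : φ u = φ z := (hsame u v huv ha).trans (hsame v z hvz hb)
    by_contra hadj
    rcases h2 u z hne hadj with ⟨-, h'⟩ | ⟨h', -⟩
    · rw [hin _ hS] at h'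
      exact absurd h' (by simp)
    · exact h' huz

end FinGraph.ClusterMapsTo

namespace CRG

open Classical in
/-- White vertices of a zero-core CRG are interchangeable. -/
theorem IsZeroCore.isEmb_swap {K : CRG} {x y : K.V} (hK : K.IsZeroCore) (hx : x ∈ K.VW)
    (hy : y ∈ K.VW) : IsEmb (L := K) (K := K) (Equiv.swap x y).toEmbedding := by
  have hw : ∀ z, K.vcol (Equiv.swap x y z) = K.vcol z := by
    intro z
    by_cases h1 : z = x
    · rw [h1, Equiv.swap_apply_left, mem_VW.1 hx, mem_VW.1 hy]
    by_cases h2 : z = y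
    · rw [h2, Equiv.swap_apply_right, mem_VW.1 hx, mem_VW.1 hy]
    rw [Equiv.swap_apply_of_ne_of_ne h1 h2]
  have hmem : ∀ z, z ∈ K.VW → Equiv.swap x y z ∈ K.VW := fun z hz => by
    rwa [mem_VW, hw, ← mem_VW]
  refine ⟨hw, fun a b hab => ?_⟩
  have hab' := (Equiv.swap x y).injective.ne hab
  change K.ecol (Equiv.swap x y a) (Equiv.swap x y b) = K.ecol a b
  by_cases ha : a ∈ K.VW
  · rw [hK.ecol_eq_gray ha hab, hK.ecol_eq_gray (hmem a ha) hab']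
  by_cases hb : b ∈ K.VW
  · rw [K.ecol_symm, hK.ecol_eq_gray (hmem b hb) hab'.symm, K.ecol_symm,
      hK.ecol_eq_gray hb hab.symm]
  have hfix : ∀ c, c ∉ K.VW → Equiv.swap x y c = c := fun c hc =>
    Equiv.swap_apply_of_ne_of_ne (by rintro rfl; exact hc hx) (by rintro rfl; exact hc hy)
  rw [hfix a ha, hfix b hb]

/-- A prescribed white vertex can be assumed to belong to the set of split white vertices. -/
theorem _root_.FinGraph.ClusterMapsTo.exists_mem {F : FinGraph} {K : CRG} {S : Finset K.V} {x : K.V}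
    (h : F.ClusterMapsTo K S) (hK : K.IsZeroCore) (hS : S ⊆ K.VW) (hne : S.Nonempty)
    (hx : x ∈ K.VW) :
    ∃ T ⊆ K.VW, T.card = S.card ∧ x ∈ T ∧ F.ClusterMapsTo K T := by
  classical
  obtain ⟨y, hy⟩ := hne
  have he := hK.isEmb_swap hx (hS hy)
  refine ⟨S.map (Equiv.swap x y).toEmbedding, he.map_subset_VW hS, Finset.card_map _, ?_, h.map he⟩
  exact Finset.mem_map.2 ⟨y, hy, Equiv.swap_apply_right x y⟩

/-- If the white vertex `x` arose by whitening, then in a cluster map that splits `x` the fibre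
over `x` can be distributed over a set `X` of black vertices, one for each clique of the fibre. -/
theorem _root_.FinGraph.ClusterMapsTo.of_whiten {F : FinGraph} {K : CRG} {x : K.V}
    {X : Finset K.V} {s : Set K.V} {hs : s.Nonempty}
    (hX : ∀ z ∈ X, z ∉ K.VW) (hXs : ∀ y ∈ s, y ≠ x → ∀ z ∈ X, z ≠ y ∧ K.ecol z y = EColor.gray)
    (hcard : Fintype.card F.V ≤ X.card) {S : Finset ((K.whiten x).induce s hs).V}
    (hS : ∃ x' ∈ S, Subtype.val (p := (· ∈ s)) x' = x)
    (h : F.ClusterMapsTo ((K.whiten x).induce s hs) S) :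
    ∃ T : Finset K.V, T.card + 1 = S.card ∧
      (∀ y ∈ T, ∃ y' ∈ S, Subtype.val (p := (· ∈ s)) y' = y ∧ y ≠ x) ∧
      F.ClusterMapsTo K T := by
  classical
  obtain ⟨φ₀, h1, h2, h3⟩ := h
  obtain ⟨x', hx'S, hx'⟩ := hS
  let val : ((K.whiten x).induce s hs).V ↪ K.V := Function.Embedding.subtype s
  set φ : F.V → K.V := fun u => val (φ₀ u) with hφ
  have hval : ∀ u, φ₀ u ∈ S.erase x' ↔ φ₀ u ∈ S ∧ φ u ≠ x := by
    intro u
    rw [Finset.mem_erase, and_comm, ← hx']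
    exact and_congr_right fun _ => not_congr (Subtype.ext_iff (a1 := φ₀ u) (a2 := x'))
  have hfib : ∀ u, φ u = x → φ₀ u = x' := fun u hu => Subtype.ext (hu.trans hx'.symm)
  -- on the fibre over `x` the classes of this setoid are the cliques
  let r : Setoid F.V :=
    { r := fun u v => u = v ∨ (φ u = x ∧ φ v = x ∧ F.graph.Adj u v)
      iseqv := by
        refine ⟨fun u => Or.inl rfl, ?_, ?_⟩
        · rintro u v (rfl | ⟨hu, hv, ha⟩)
          exacts [Or.inl rfl, Or.inr ⟨hv, hu, ha.symm⟩]
        · rintro u v z (rfl | ⟨hu, hv, ha⟩) (rfl | ⟨hv', hz, hb⟩)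
          · exact Or.inl rfl
          · exact Or.inr ⟨hv', hz, hb⟩
          · exact Or.inr ⟨hu, hv, ha⟩
          · by_cases huz : u = z
            · exact Or.inl huz
            · refine Or.inr ⟨hu, hz, h3 u v z ?_ ?_ ?_ ha hb huz⟩
              · rw [hfib u hu, hfib v hv]
              · rw [hfib v hv, hfib z hz]
              · rwa [hfib u hu] }
  obtain ⟨c⟩ : Nonempty (Quotient r ↪ X) := by
    refine Function.Embedding.nonempty_of_card_le ?_
    rw [Fintype.card_coe]
    exact (Fintype.card_quotient_le r).trans hcard
  have hc : ∀ u v, φ u = x → φ v = x → u ≠ v →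
      ((c ⟦u⟧ : K.V) = c ⟦v⟧ ↔ F.graph.Adj u v) := by
    intro u v hu hv hne
    rw [Subtype.coe_inj, c.injective.eq_iff, Quotient.eq]
    constructor
    · rintro (h | h)
      exacts [absurd h hne, h.2.2]
    · exact fun h => Or.inr ⟨hu, hv, h⟩
  have hcX : ∀ u, (c ⟦u⟧ : K.V) ∈ X := fun u => (c ⟦u⟧).2
  have hcs : ∀ u v, φ v ≠ x → (c ⟦u⟧ : K.V) ≠ φ v ∧ K.ecol (c ⟦u⟧) (φ v) = EColor.gray :=
    fun u v hv => hXs _ (φ₀ v).2 hv _ (hcX u)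
  have hT : ∀ y ∈ (S.erase x').map val, ∃ y' ∈ S, Subtype.val (p := (· ∈ s)) y' = y ∧ y ≠ x := by
    intro y hy
    obtain ⟨y', hy', rfl⟩ := Finset.mem_map.1 hy
    refine ⟨y', Finset.mem_of_mem_erase hy', rfl, fun h => Finset.ne_of_mem_erase hy' ?_⟩
    exact Subtype.ext (h.trans hx'.symm)
  refine ⟨(S.erase x').map val, ?_, hT, fun u => if φ u = x then (c ⟦u⟧ : K.V) else φ u,
    fun u v huv hne => ?_, fun u v huv heq hS => ?_, fun u v z huv hvz hS ha hb hne => ?_⟩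
  · rw [Finset.card_map, Finset.card_erase_add_one hx'S]
  · by_cases hu : φ u = x <;> by_cases hv : φ v = x
    · simp only [hu, hv, if_true] at hne
      exact absurd ((hc u v hu hv huv.ne).2 huv) hne
    · simp only [hu, hv, if_true, if_false]
      exact (hcs u v hv).2
    · simp only [hu, hv, if_true, if_false]
      rw [K.ecol_symm]
      exact (hcs v u hu).2
    · simp only [hu, hv, if_false] at hne ⊢
      have := h1 u v huv fun h => hne (congrArg val h)
      change (K.whiten x).ecol (φ u) (φ v) = _ at this
      simpa [hu, hv] using this
  · by_cases hu : φ u = x <;> by_cases hv : φ v = x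
    · simp only [hu, hv, if_true] at heq ⊢
      rw [hc u v hu hv huv] at heq
      exact iff_of_true heq (notMem_VW.1 (hX _ (hcX u)))
    · simp only [hu, hv, if_true, if_false] at heq
      exact absurd heq (hcs u v hv).1
    · simp only [hu, hv, if_true, if_false] at heq
      exact absurd heq.symm (hcs v u hu).1
    · simp only [hu, hv, if_false] at heq hS ⊢
      rw [h2 u v huv (Subtype.ext heq) fun h =>
        hS (Finset.mem_map_of_mem val ((hval u).2 ⟨h, hu⟩))]
      change (K.whiten x).vcol (φ u) = _ ↔ _
      simp [hu]
  · by_cases hu : φ u = x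
    · simp only [hu, if_true] at hS
      obtain ⟨y', -, hy', hyx⟩ := hT _ hS
      exact absurd hy'.symm (hXs _ y'.2 (by rwa [hy']) _ (hcX u)).1
    · simp only [hu, if_false] at huv hS
      have hv : φ v ≠ x := fun hv => by
        simp only [hv, if_true] at huv
        exact (hcs v u hu).1 huv.symm
      simp only [hv, if_false] at huv hvz
      have hz : φ z ≠ x := fun hz => by
        simp only [hz, if_true] at hvz
        exact (hcs z v hv).1 hvz.symm
      simp only [hz, if_false] at hvz
      obtain ⟨w, hw, hw'⟩ := Finset.mem_map.1 hS
      have : w = φ₀ u := val.injective hw'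
      exact h3 u v z (Subtype.ext huv) (Subtype.ext hvz)
        (Finset.mem_of_mem_erase (this ▸ hw)) ha hb hne

end CRG

/-! ### Sampling -/

theorem exists_le_sum_of_mem_stdSimplex {V : Type*} [Fintype V] {μ : V → ℝ}
    (hμ : μ ∈ stdSimplex ℝ V) (k : V → ℝ) : ∃ u, k u ≤ ∑ v, μ v * k v := by
  by_contra! h
  obtain ⟨u, hu⟩ : ∃ u, 0 < μ u := by
    by_contra! hall
    have := Finset.sum_nonpos fun v (_ : v ∈ Finset.univ) => hall v
    rw [hμ.2] at this
    linarith
  set A := ∑ v, μ v * k v with hA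
  have h1 : ∑ v, μ v * A < ∑ v, μ v * k v :=
    Finset.sum_lt_sum (fun v _ => mul_le_mul_of_nonneg_left (h v).le (hμ.1 v))
      ⟨u, Finset.mem_univ _, mul_lt_mul_of_pos_left (h u) hu⟩
  rw [← Finset.sum_mul, hμ.2, one_mul] at h1
  exact lt_irrefl _ h1

/-- Among the samples of `T` points there is one on which the sum of a kernel `h ≤ C`, plus that of
a function `k`, is at most its expectation (with `C` as a bound for the diagonal terms).  The points
are chosen one by one; the function `k` records the interaction with the points chosen before. -/
theorem exists_sample_sum_add_le {V : Type*} [Fintype V] {μ : V → ℝ} (hμ : μ ∈ stdSimplex ℝ V)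
    {h : V → V → ℝ} {C : ℝ} (hC : ∀ u, h u u ≤ C) (T : ℕ) (k : V → ℝ) :
    ∃ f : Fin T → V, ∑ i, ∑ j, h (f i) (f j) + ∑ i, k (f i) ≤
      T * C + T * (T - 1) * ∑ u, ∑ v, μ u * μ v * h u v + T * ∑ v, μ v * k v := by
  induction T generalizing k with
  | zero => exact ⟨Fin.elim0, by simp⟩
  | succ T ih =>
    set G := ∑ u, ∑ v, μ u * μ v * h u v with hG
    obtain ⟨u, hu⟩ := exists_le_sum_of_mem_stdSimplex hμ
      fun u => k u + T * ∑ v, μ v * (h u v + h v u + k v)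
    obtain ⟨f, hf⟩ := ih fun v => h u v + h v u + k v
    refine ⟨Fin.cons u f, ?_⟩
    have hG' : ∑ u, ∑ v, μ u * μ v * h v u = G := by
      rw [hG, Finset.sum_comm]
      exact Finset.sum_congr rfl fun _ _ => Finset.sum_congr rfl fun _ _ => by ring
    have havg : ∑ u, μ u * (k u + T * ∑ v, μ v * (h u v + h v u + k v)) =
        ∑ v, μ v * k v + T * (2 * G + ∑ v, μ v * k v) := by
      have h1 : ∀ u, μ u * (k u + T * ∑ v, μ v * (h u v + h v u + k v)) =
          μ u * k u + T * (∑ v, μ u * μ v * h u v + ∑ v, μ u * μ v * h v u +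
            μ u * ∑ v, μ v * k v) := by
        intro u
        have : ∑ v, μ v * (h u v + h v u + k v) =
            ∑ v, μ v * h u v + ∑ v, μ v * h v u + ∑ v, μ v * k v := by
          simp only [mul_add, Finset.sum_add_distrib]
        simp only [this, mul_assoc, ← Finset.mul_sum]
        ring
      simp only [h1, Finset.sum_add_distrib, ← Finset.mul_sum, ← Finset.sum_mul, hμ.2, hG', ← hG]
      ring
    rw [havg] at hu
    simp only [Fin.sum_univ_succ, Fin.cons_zero, Fin.cons_succ, Finset.sum_add_distrib] at hf ⊢
    push_cast
    have := hC u
    nlinarith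

theorem exists_sample_sum_le {V : Type*} [Fintype V] {μ : V → ℝ} (hμ : μ ∈ stdSimplex ℝ V)
    {h : V → V → ℝ} {C : ℝ} (hC : ∀ u, h u u ≤ C) (T : ℕ) :
    ∃ f : Fin T → V, ∑ i, ∑ j, h (f i) (f j) ≤
      T * C + T * (T - 1) * ∑ u, ∑ v, μ u * μ v * h u v := by
  simpa using exists_sample_sum_add_le hμ hC T fun _ => 0

namespace CRG

/-! ### Splitting off a white vertex -/

/-- A single sample of `⌈2 / ε⌉` vertices approximates the symmetrizations at a positive proportion
of all black vertices. -/
theorem IsCore.exists_sample {K : CRG} {p : ℝ} (hK : K.IsCore p) (hp0 : 0 < p) (hp1 : p < 1 / 2)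
    {ε : ℝ} (hε0 : 0 < ε) (hε1 : ε ≤ 1) {T : ℕ} (hT : 2 / ε ≤ T) (B : Finset K.V) :
    ∃ (f : Fin T → K.V) (X : Finset K.V), X ⊆ B ∧ B.card * ε ≤ 4 * X.card ∧
      ∀ x ∈ X, ∑ i, ∑ j, (K.whiten x).M p (K.collapse x (f i)) (K.collapse x (f j)) ≤
        T ^ 2 * (K.g p + ε) := by
  classical
  obtain ⟨μ, hμ, -, hopt⟩ := hK.exists_optimal hp0 (by linarith)
  set H : K.V → K.V → K.V → ℝ := fun x u v =>
    (K.whiten x).M p (K.collapse x u) (K.collapse x v) with hH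
  have hT0 : (0 : ℝ) < T := lt_of_lt_of_le (by positivity) hT
  have hT1 : (1 : ℝ) ≤ T := by
    have : 0 < T := by exact_mod_cast hT0
    exact_mod_cast this
  obtain ⟨f, hf⟩ := exists_sample_sum_le hμ (h := fun u v => ∑ x ∈ B, H x u v) (C := B.card)
    (fun u => by
      have := Finset.sum_le_card_nsmul B (fun x => H x u u) 1 fun x _ =>
        (K.whiten x).M_le_one hp0.le (by linarith) _ _
      simpa using this) T
  set V : K.V → ℝ := fun x => ∑ i, ∑ j, H x (f i) (f j) with hV
  have hV0 : ∀ x, 0 ≤ V x := fun x => Finset.sum_nonneg fun i _ => Finset.sum_nonneg fun j _ =>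
    (K.whiten x).M_nonneg hp0.le (by linarith) _ _
  have e1 : ∑ i, ∑ j, ∑ x ∈ B, H x (f i) (f j) = ∑ x ∈ B, V x := by
    rw [hV, Finset.sum_comm (s := B)]
    exact Finset.sum_congr rfl fun i _ => Finset.sum_comm
  have e2 : ∑ u, ∑ v, μ u * μ v * ∑ x ∈ B, H x u v ≤ B.card * K.g p := by
    have : ∑ u, ∑ v, μ u * μ v * ∑ x ∈ B, H x u v =
        ∑ x ∈ B, ∑ u, ∑ v, μ u * μ v * H x u v := by
      simp only [Finset.mul_sum]
      rw [Finset.sum_comm (s := B)]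
      exact Finset.sum_congr rfl fun i _ => Finset.sum_comm
    rw [this, ← nsmul_eq_mul]
    exact Finset.sum_le_card_nsmul _ _ _ fun x _ =>
      K.sum_whiten_collapse_le hp0.le hp1.le hμ hopt x
  refine ⟨f, B.filter fun x => V x ≤ T ^ 2 * (K.g p + ε), Finset.filter_subset _ _, ?_,
    fun x hx => (Finset.mem_filter.1 hx).2⟩
  set X := B.filter fun x => V x ≤ T ^ 2 * (K.g p + ε) with hX
  set Y := B.filter fun x => ¬ V x ≤ T ^ 2 * (K.g p + ε) with hY
  have hg0 := K.g_nonneg hp0.le (by linarith : p ≤ 1)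
  have hg1 := K.g_le_one hp0.le (by linarith : p ≤ 1)
  have hXY : (X.card : ℝ) + Y.card = B.card := by
    exact_mod_cast Finset.card_filter_add_card_filter_not _
  -- Markov's inequality
  have h1 : Y.card * (T ^ 2 * (K.g p + ε)) ≤ ∑ x ∈ B, V x := by
    rw [← nsmul_eq_mul]
    refine (Finset.card_nsmul_le_sum Y V _ fun x hx =>
      (not_le.1 (Finset.mem_filter.1 hx).2).le).trans ?_
    exact Finset.sum_le_sum_of_subset_of_nonneg (Finset.filter_subset _ _) fun x _ _ => hV0 x
  rw [e1] at hf
  have h2 : ∑ x ∈ B, V x ≤ T * B.card + T * (T - 1) * (B.card * K.g p) :=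
    hf.trans (by
      have : (0 : ℝ) ≤ T * (T - 1) := mul_nonneg hT0.le (by linarith)
      linarith [mul_le_mul_of_nonneg_left e2 this])
  have hB0 : (0 : ℝ) ≤ B.card := by positivity
  have hX0 : (0 : ℝ) ≤ X.card := by positivity
  have hTε : 2 ≤ T * ε := by rwa [div_le_iff₀ hε0] at hT
  have h3 : T ^ 2 * (Y.card * (K.g p + ε)) ≤ T ^ 2 * (B.card * (K.g p + ε / 2)) := by
    have a1 : (T : ℝ) * B.card ≤ T * B.card * (T * ε / 2) :=
      le_mul_of_one_le_right (by positivity) (by linarith)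
    have a2 : 0 ≤ T * (B.card * K.g p) := by positivity
    nlinarith
  have h4 := le_of_mul_le_mul_left h3 (by positivity)
  have h5 : X.card * (K.g p + ε) ≤ X.card * 2 := mul_le_mul_of_nonneg_left (by linarith) hX0
  have : (Y.card : ℝ) = B.card - X.card := by linarith
  rw [this] at h4
  nlinarith

/-- No member of `𝓕` has a cluster map to `K` that splits `d` white vertices. -/
def AvoidsClusterMaps (𝓕 : Set FinGraph) (K : CRG) (d : ℕ) : Prop :=
  ∀ F ∈ 𝓕, ∀ S ⊆ K.VW, S.card = d → ¬ F.ClusterMapsTo K S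

theorem AvoidsClusterMaps.of_isEmb {𝓕 : Set FinGraph} {L K : CRG} {d : ℕ}
    (h : AvoidsClusterMaps 𝓕 K d) {e : L.V ↪ K.V} (he : IsEmb e) : AvoidsClusterMaps 𝓕 L d :=
  fun F hF _ hS hd hm => h F hF _ (he.map_subset_VW hS) ((Finset.card_map e).trans hd) (hm.map he)

/-- A core CRG with very many vertices gives rise to a CRG of bounded size, of almost the same
value and with one more white vertex; this white vertex can be split into `ℓ` black ones. -/
theorem exists_whiten_avoids (𝓕 : Set FinGraph) (m d ℓ : ℕ) {ε : ℝ} (hε0 : 0 < ε) (hε1 : ε ≤ 1) :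
    ∃ N : ℕ, ∀ (Γ : CRG) (q : ℝ), 0 < q → q < 1 / 2 → Γ.IsCore q → Γ.VW.card = m →
      AvoidsClusterMaps 𝓕 Γ d → N ≤ Fintype.card Γ.V →
      ∃ K : CRG, K.IsZeroCore ∧ K.VW.card = m + 1 ∧ Fintype.card K.V ≤ ⌈2 / ε⌉₊ + m + 1 ∧
        K.g q ≤ Γ.g q + ε ∧ AvoidsClusterMaps {F ∈ 𝓕 | Fintype.card F.V ≤ ℓ} K (d + 1) := by
  classical
  set T := ⌈2 / ε⌉₊ with hTdef
  -- a proportion `ε / 4` of the black vertices has to exceed `ℓ` times the number of subsets of a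
  -- sample of `T` vertices
  refine ⟨m + (⌈4 * (2 ^ T * ℓ) / ε⌉₊ + 1), fun Γ q hq0 hq1 hΓ hm havoid hN => ?_⟩
  have hzero := hΓ.isZeroCore hq0 hq1
  have hT : 2 / ε ≤ T := Nat.le_ceil _
  have hT0 : (0 : ℝ) < T := lt_of_lt_of_le (by positivity) hT
  obtain ⟨f, X₀, hX₀B, hX₀card, hX₀⟩ := hΓ.exists_sample hq0 hq1 hε0 hε1 hT Γ.VWᶜ
  have hcard : 2 ^ T * ℓ < X₀.card := by
    have h1 : ⌈4 * (2 ^ T * ℓ) / ε⌉₊ + 1 ≤ (Γ.VWᶜ).card := by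
      rw [Finset.card_compl, hm]
      omega
    have h2 : 4 * (2 ^ T * ℓ) / ε < (Γ.VWᶜ).card :=
      (Nat.le_ceil _).trans_lt (by exact_mod_cast h1)
    rw [div_lt_iff₀ hε0] at h2
    have h3 : (2 ^ T * ℓ : ℝ) < X₀.card := by linarith
    exact_mod_cast h3
  -- many of the black vertices have the same gray neighbours in the sample
  set I : Finset Γ.V := Finset.univ.image f with hI
  have hIcard : I.card ≤ T := Finset.card_image_le.trans_eq (by simp)
  set tr : Γ.V → Finset Γ.V := fun x => I.filter fun y => y ≠ x ∧ Γ.ecol x y = EColor.gray with htr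
  obtain ⟨Y, hY, hXcard⟩ := Finset.exists_lt_card_fiber_of_mul_lt_card_of_maps_to (s := X₀)
    (t := I.powerset) (f := tr) (n := ℓ)
    (fun x _ => Finset.mem_powerset.2 (Finset.filter_subset _ _))
    (lt_of_le_of_lt (Nat.mul_le_mul_right _ (by
      rw [Finset.card_powerset]
      exact Nat.pow_le_pow_right (by norm_num) hIcard)) hcard)
  set X := X₀.filter fun x => tr x = Y with hX
  obtain ⟨x, hx⟩ : X.Nonempty := Finset.card_pos.1 (by omega)
  have hXtr : ∀ z ∈ X, tr z = Y := fun z hz => (Finset.mem_filter.1 hz).2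
  have hXblack : ∀ z ∈ X, z ∉ Γ.VW := fun z hz =>
    Finset.mem_compl.1 (hX₀B (Finset.mem_filter.1 hz).1)
  set s : Finset Γ.V := Y ∪ insert x Γ.VW with hs
  have hxs : x ∈ s := by simp [hs]
  have hne : (s : Set Γ.V).Nonempty := ⟨x, hxs⟩
  have hemb := (Γ.whiten x).isEmb_induce (s : Set Γ.V) hne
  have hzero' := hemb.isZeroCore (hzero.whiten x)
  have hVW : ∀ y, y ∈ (Γ.whiten x).VW ↔ y = x ∨ y ∈ Γ.VW := by
    intro y
    rw [mem_VW, mem_VW]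
    by_cases hy : y = x <;> simp [hy]
  have hVWcard : ((Γ.whiten x).induce (s : Set Γ.V) hne).VW.card = m + 1 := by
    rw [hemb.card_VW_eq fun y hy => ?_, ← hm, ← Finset.card_insert_of_notMem (hXblack x hx)]
    · congr 1
      ext y
      rw [hVW, Finset.mem_insert]
    · refine ⟨(⟨y, ?_⟩ : (s : Set Γ.V)), rfl⟩
      have := (hVW y).1 hy
      simp only [hs, Finset.coe_union, Set.mem_union, Finset.mem_coe, Finset.mem_insert]
      exact Or.inr this
  refine ⟨(Γ.whiten x).induce (s : Set Γ.V) hne, hzero', hVWcard, ?_, ?_, ?_⟩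
  · have h1 : Fintype.card ((Γ.whiten x).induce (s : Set Γ.V) hne).V = s.card := by
      rw [← Nat.card_eq_fintype_card]
      exact (Nat.card_eq_fintype_card (α := s)).trans (Fintype.card_coe s)
    have h2 : Y.card ≤ T := (Finset.card_le_card (Finset.mem_powerset.1 hY)).trans hIcard
    have h3 : s.card ≤ Y.card + (insert x Γ.VW).card := Finset.card_union_le _ _
    have h4 := Finset.card_insert_le x Γ.VW
    omega
  · have hmem : (fun _ : Fin T => (T : ℝ)⁻¹) ∈ stdSimplex ℝ (Fin T) :=
      ⟨fun _ => by positivity, by simp [hT0.ne']⟩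
    refine ((Γ.whiten x).g_induce_le_sum q (s : Set Γ.V) hne hmem
      (fun i => Γ.collapse x (f i)) fun i => ?_).trans ?_
    · change Γ.collapse x (f i) ∈ s
      rcases Γ.collapse_eq_self_or x (f i) with h | ⟨h, h'⟩
      · rwa [h]
      · rw [h, hs, Finset.mem_union, ← hXtr x hx]
        exact Or.inl (Finset.mem_filter.2 ⟨Finset.mem_image_of_mem f (Finset.mem_univ i), h'⟩)
    · simp only [← Finset.mul_sum]
      have := hX₀ x (Finset.mem_filter.1 hx).1
      rw [← mul_inv, ← div_eq_inv_mul, div_le_iff₀ (by positivity)]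
      linarith
  · rintro F ⟨hF, hFℓ⟩ S hS hSd hmap
    have hw : ∀ z : ((Γ.whiten x).induce (s : Set Γ.V) hne).V,
        z ∈ ((Γ.whiten x).induce (s : Set Γ.V) hne).VW ↔
          Subtype.val (p := (· ∈ (s : Set Γ.V))) z ∈ (Γ.whiten x).VW := by
      intro z
      rw [mem_VW, mem_VW]
      exact Iff.rfl
    have hxw : (⟨x, hxs⟩ : (s : Set Γ.V)) ∈ ((Γ.whiten x).induce (s : Set Γ.V) hne).VW :=
      (hw _).2 ((hVW x).2 (Or.inl rfl))
    obtain ⟨S', hS', hcardS, hxS', hmap'⟩ := hmap.exists_mem hzero' hS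
      (Finset.card_pos.1 (by omega)) hxw
    have hXs : ∀ y ∈ (s : Set Γ.V), y ≠ x → ∀ z ∈ X, z ≠ y ∧ Γ.ecol z y = EColor.gray := by
      intro y hy hyx z hz
      have hy' : y = x ∨ y ∈ Y ∨ y ∈ Γ.VW := by simpa [hs] using hy
      rcases hy' with h | h | h
      · exact absurd h hyx
      · rw [← hXtr z hz] at h
        obtain ⟨-, h1, h2⟩ := Finset.mem_filter.1 h
        exact ⟨h1.symm, h2⟩
      · have hzy : z ≠ y := fun h' => hXblack z hz (h' ▸ h)
        exact ⟨hzy, by rw [Γ.ecol_symm]; exact hzero.ecol_eq_gray h hzy.symm⟩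
    obtain ⟨R, hR, hRS, hmapR⟩ := hmap'.of_whiten hXblack hXs
      (hFℓ.trans hXcard.le) ⟨_, hxS', rfl⟩
    refine havoid F hF R (fun y hy => ?_) (by omega) hmapR
    obtain ⟨y', hy', rfl, hyx⟩ := hRS y hy
    exact ((hVW _).1 ((hw y').1 (hS' hy'))).resolve_left hyx

end CRG

/-! ### Finiteness up to isomorphism -/

instance : Finite VColor :=
  Finite.of_injective (fun c : VColor => c matches VColor.black)
    (by rintro (_ | _) (_ | _) h <;> simp_all)

instance : Finite EColor :=
  Finite.of_injective (fun c : EColor => (c matches EColor.black, c matches EColor.white))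
    (by rintro (_ | _ | _) (_ | _ | _) h <;> simp_all)

namespace CRG

/-- There are only finitely many CRGs of bounded size up to isomorphism. -/
theorem exists_frequently_iso {N : ℕ} (K : ℕ → CRG) (hK : ∀ n, Fintype.card (K n).V ≤ N) :
    ∃ m, ∃ᶠ n in atTop, (K m).Iso (K n) := by
  have hsurj : ∀ n, ∃ f : Fin N → (K n).V, Function.Surjective f := fun n => by
    obtain ⟨e⟩ : Nonempty ((K n).V ↪ Fin N) :=
      Function.Embedding.nonempty_of_card_le (by simpa using hK n)
    exact ⟨_, Function.invFun_surjective e.injective⟩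
  choose f hf using hsurj
  -- pull everything back to `Fin N`
  let code : ℕ → (Fin N → Fin N → Prop) × (Fin N → VColor) × (Fin N → Fin N → EColor) := fun n =>
    (fun i j => f n i = f n j, fun i => (K n).vcol (f n i), fun i j => (K n).ecol (f n i) (f n j))
  obtain ⟨y, hy⟩ := Finite.exists_infinite_fiber code
  rw [Set.infinite_coe_iff] at hy
  obtain ⟨m, hm⟩ := hy.nonempty
  refine ⟨m, Nat.frequently_atTop_iff_infinite.2 (hy.mono fun n hn => ?_)⟩
  have hmn : code m = code n := (Set.mem_singleton_iff.1 hm).trans (Set.mem_singleton_iff.1 hn).symm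
  simp only [code, Prod.mk.injEq] at hmn
  obtain ⟨h1, h2, h3⟩ := hmn
  have h1' : ∀ i j, f m i = f m j ↔ f n i = f n j := fun i j =>
    iff_of_eq (congrFun (congrFun h1 i) j)
  let r := Function.surjInv (hf m)
  have hr : ∀ x, f m (r x) = x := Function.surjInv_eq (hf m)
  refine ⟨Equiv.ofBijective (fun x => f n (r x)) ⟨fun x y hxy => ?_, fun z => ?_⟩,
    fun x => ?_, fun x y _ => ?_⟩
  · rw [← hr x, ← hr y]
    exact (h1' _ _).2 hxy
  · obtain ⟨i, rfl⟩ := hf n z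
    exact ⟨f m i, (h1' _ _).1 (hr _)⟩
  · have h := (congrFun h2 (r x)).symm
    rw [hr] at h
    exact h
  · have h := (congrFun (congrFun h3 (r x)) (r y)).symm
    rw [hr, hr] at h
    exact h

theorem Iso.g_le {K L : CRG} (h : K.Iso L) (p : ℝ) : K.g p ≤ L.g p := by
  obtain ⟨e, he, -⟩ := h.symm.exists_isEmb
  exact he.g_le p

/-- Arbitrarily large core CRGs of value about `c`, at parameters close to `p`, yield `p`-core CRGs
of value about `c` with one more white vertex, which can be split.  The size of the CRGs that arise
from whitening depends only on `ε`, so that one of them serves members of `𝓕` of any order. -/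
theorem exists_whiten_core {𝓕 : Set FinGraph} {p c : ℝ} (hp0 : 0 < p) (hp1 : p < 1) {m d : ℕ}
    (H : ∀ ε > 0, ∀ N : ℕ, ∃ (Γ : CRG) (q : ℝ), 0 < q ∧ q < 1 / 2 ∧ |p - q| ≤ ε ∧ Γ.IsCore q ∧
      Γ.VW.card = m ∧ AvoidsClusterMaps 𝓕 Γ d ∧ N ≤ Fintype.card Γ.V ∧ Γ.g q ≤ c + ε)
    {ε : ℝ} (hε : 0 < ε) :
    ∃ K : CRG, K.IsCore p ∧ K.VW.card = m + 1 ∧ AvoidsClusterMaps 𝓕 K (d + 1) ∧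
      K.g p ≤ c + ε := by
  set δ := min (ε / 3) 1 with hδ
  have hδ0 : 0 < δ := lt_min (by linarith) one_pos
  have hδε : δ ≤ ε / 3 := min_le_left _ _
  have hstep : ∀ ℓ : ℕ, ∃ K : CRG, K.IsZeroCore ∧ K.VW.card = m + 1 ∧
      Fintype.card K.V ≤ ⌈2 / δ⌉₊ + m + 1 ∧ K.g p ≤ c + ε ∧
      AvoidsClusterMaps {F ∈ 𝓕 | Fintype.card F.V ≤ ℓ} K (d + 1) := by
    intro ℓ
    obtain ⟨N, hN⟩ := exists_whiten_avoids 𝓕 m d ℓ hδ0 (min_le_right _ _)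
    obtain ⟨Γ, q, hq0, hq1, hpq, hΓ, hm, hav, hcard, hg⟩ := H δ hδ0 N
    obtain ⟨K, hK0, hKm, hKc, hKg, hKa⟩ := hN Γ q hq0 hq1 hΓ hm hav hcard
    exact ⟨K, hK0, hKm, hKc, by linarith [K.g_le_add_abs p q], hKa⟩
  choose K hK0 hKm hKc hKg hKa using hstep
  -- by finiteness, one and the same CRG works for all `ℓ`
  obtain ⟨ℓ₀, hℓ₀⟩ := exists_frequently_iso K hKc
  have hav : AvoidsClusterMaps 𝓕 (K ℓ₀) (d + 1) := by
    intro F hF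
    obtain ⟨ℓ, hℓ, hiso⟩ := (frequently_atTop.1 hℓ₀) (Fintype.card F.V)
    obtain ⟨e, he, -⟩ := hiso.exists_isEmb
    exact (hKa ℓ).of_isEmb he F ⟨hF, hℓ⟩
  obtain ⟨L, e, he, hL, hLg⟩ := exists_isEmb_isCore hp0 hp1 (K ℓ₀)
  exact ⟨L, hL, (he.card_VW_eq fun x hx =>
    he.mem_range_of_mem_VW (hK0 ℓ₀) hp0 hp1 hLg hx).trans (hKm ℓ₀), hav.of_isEmb he,
    hLg.trans (hKg ℓ₀)⟩

/-- White vertices that can be split are created one by one, until an exact minimizer is found; their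
number is bounded because the white vertices of a core CRG span a gray clique.  Here `d` counts the
vertices that can be split already, and `k` bounds the number of further rounds. -/
theorem exists_core_of_large {𝓕 : Set FinGraph} {F₀ : FinGraph} (hF₀ : F₀ ∈ 𝓕) {p c : ℝ}
    (hp0 : 0 < p) (hp1 : p < 1 / 2) (w k : ℕ) (d : ℕ) (hk : Fintype.card F₀.V ≤ w + d + k)
    (H : ∀ ε > 0, ∀ N : ℕ, ∃ (Γ : CRG) (q : ℝ), 0 < q ∧ q < 1 / 2 ∧ |p - q| ≤ ε ∧ Γ.IsCore q ∧
      Γ.VW.card = w + d ∧ AvoidsClusterMaps 𝓕 Γ d ∧ N ≤ Fintype.card Γ.V ∧ Γ.g q ≤ c + ε) :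
    ∃ (K : CRG) (d' : ℕ), 0 < d' ∧ K.IsCore p ∧ K.VW.card = w + d' ∧ AvoidsClusterMaps 𝓕 K d' ∧
      K.g p ≤ c := by
  induction k generalizing d with
  | zero =>
    obtain ⟨Γ, q, hq0, hq1, -, hΓ, hm, hav, -, -⟩ := H 1 one_pos 0
    obtain ⟨S, hS, hSd⟩ := Finset.exists_subset_card_eq (show d ≤ Γ.VW.card by omega)
    exact absurd (FinGraph.ClusterMapsTo.of_card_le (hΓ.isZeroCore hq0 hq1) (by omega) S)
      (hav F₀ hF₀ S hS hSd)
  | succ k ih =>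
    by_cases hbdd : ∃ N : ℕ, ∀ ε > 0, ∃ K : CRG, K.IsCore p ∧ K.VW.card = w + d + 1 ∧
        AvoidsClusterMaps 𝓕 K (d + 1) ∧ K.g p ≤ c + ε ∧ Fintype.card K.V ≤ N
    · obtain ⟨N, hN⟩ := hbdd
      choose K hK hKm hKa hKg hKN using fun n : ℕ => hN (1 / ((n : ℝ) + 1)) (by positivity)
      obtain ⟨m, hm⟩ := exists_frequently_iso K hKN
      refine ⟨K m, d + 1, by omega, hK m, hKm m, hKa m, ?_⟩
      have hlim : Tendsto (fun n : ℕ => c + 1 / ((n : ℝ) + 1)) atTop (𝓝 (c + 0)) :=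
        tendsto_const_nhds.add tendsto_one_div_add_atTop_nhds_zero_nat
      rw [add_zero] at hlim
      exact ge_of_tendsto_of_frequently hlim (hm.mono fun n hn => (hn.g_le p).trans (hKg n))
    · push Not at hbdd
      refine ih (d + 1) (by omega) fun ε hε N => ?_
      obtain ⟨ε₀, hε₀, hlarge⟩ := hbdd N
      obtain ⟨K, hK, hKm, hKa, hKg⟩ :=
        exists_whiten_core hp0 (by linarith) H (lt_min hε hε₀)
      refine ⟨K, p, hp0, hp1, by simpa using hε.le, hK, hKm, hKa, ?_, ?_⟩
      · exact (hlarge K hK hKm hKa (hKg.trans (by linarith [min_le_right ε ε₀]))).le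
      · exact hKg.trans (by linarith [min_le_left ε ε₀])

end CRG

theorem mainTheorem4 (𝓕 : Set FinGraph) (h𝓕 : 𝓕.Nonempty)
    (hH : NontrivialProperty (Forb 𝓕)) (p : ℝ) (hp0 : 0 < p) (hp1 : p < 1 / 2)
    (Γ : ℕ → CRG) (q : ℕ → ℝ) (w : ℕ)
    (hq : Tendsto q atTop (𝓝 p))
    (hΓ : ∀ n, Γ n ∈ CRG.coreClass 𝓕 (q n))
    (hw : limsup (fun n => ((Γ n).VW.card : ℕ∞)) atTop = (w : ℕ∞))
    (hdist : Pairwise fun m n => ¬ (Γ m).Iso (Γ n)) :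
    ∃ K ∈ CRG.coreClass 𝓕 p,
      K.g p ≤ limsup (fun n => (Γ n).g (q n)) atTop ∧
      w < K.VW.card ∧
      ∀ (r ℓ : ℕ) (hℓ : 1 ≤ ℓ), 1 ≤ r → r ≤ K.VW.card - w →
        ∀ S ⊆ K.VW, S.card = r → ¬ CRG.FamilyMapsTo 𝓕 (K.dalmatian S ℓ hℓ) := by
  obtain ⟨F₀, hF₀⟩ := h𝓕
  set c := limsup (fun n => (Γ n).g (q n)) atTop with hc
  have hq0 : ∀ᶠ n in atTop, 0 < q n := hq.eventually_const_lt hp0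
  have hq1 : ∀ᶠ n in atTop, q n < 1 / 2 := hq.eventually_lt_const hp1
  have hbdd : IsBoundedUnder (· ≤ ·) atTop fun n => (Γ n).g (q n) := by
    refine isBoundedUnder_of_eventually_le (a := 1) ?_
    filter_upwards [hq0, hq1] with n h0 h1 using (Γ n).g_le_one h0.le (by linarith)
  have hwle : ∀ᶠ n in atTop, (Γ n).VW.card ≤ w := by
    have : limsup (fun n => ((Γ n).VW.card : ℕ∞)) atTop < ((w + 1 : ℕ) : ℕ∞) := by
      rw [hw]
      exact_mod_cast Nat.lt_succ_self w
    filter_upwards [eventually_lt_of_limsup_lt this] with n hn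
    exact Nat.lt_succ_iff.1 (by exact_mod_cast hn)
  have hwge : ∃ᶠ n in atTop, w ≤ (Γ n).VW.card := by
    cases w with
    | zero => exact Frequently.of_forall fun n => Nat.zero_le _
    | succ v =>
      have : ((v : ℕ) : ℕ∞) < limsup (fun n => ((Γ n).VW.card : ℕ∞)) atTop := by
        rw [hw]
        exact_mod_cast Nat.lt_succ_self v
      refine (frequently_lt_of_lt_limsup (by isBoundedDefault) this).mono fun n hn => ?_
      exact_mod_cast hn
  -- `w` is the number of white vertices of infinitely many `Γ n`; no vertex is split yet
  have hH0 : ∀ ε > 0, ∀ N : ℕ, ∃ (G : CRG) (t : ℝ), 0 < t ∧ t < 1 / 2 ∧ |p - t| ≤ ε ∧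
      G.IsCore t ∧ G.VW.card = w + 0 ∧ CRG.AvoidsClusterMaps 𝓕 G 0 ∧ N ≤ Fintype.card G.V ∧
      G.g t ≤ c + ε := by
    intro ε hε N
    have hnear : ∀ᶠ n in atTop, |p - q n| ≤ ε := by
      filter_upwards [Metric.tendsto_nhds.1 hq ε hε] with n hn
      rw [abs_sub_comm]
      exact (Real.dist_eq _ _ ▸ hn).le
    have hval : ∀ᶠ n in atTop, (Γ n).g (q n) < c + ε :=
      eventually_lt_of_limsup_lt (by rw [← hc]; linarith) hbdd
    have hgood := hwge.and_eventually (hwle.and (hq0.and (hq1.and (hnear.and hval))))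
    obtain ⟨n, hN, h1, h2, h3, h4, h5, h6⟩ : ∃ n, N ≤ Fintype.card (Γ n).V ∧ w ≤ (Γ n).VW.card ∧
        (Γ n).VW.card ≤ w ∧ 0 < q n ∧ q n < 1 / 2 ∧ |p - q n| ≤ ε ∧ (Γ n).g (q n) < c + ε := by
      -- otherwise infinitely many pairwise non-isomorphic CRGs have fewer than `N` vertices
      by_contra! hsmall
      obtain ⟨φ, hφ, hφP⟩ := extraction_of_frequently_atTop hgood
      obtain ⟨m, hm⟩ := CRG.exists_frequently_iso (N := N) (fun n => Γ (φ n)) fun n => by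
        by_contra! hlt
        obtain ⟨a1, a2, a3, a4, a5, a6⟩ := hφP n
        exact absurd a6 (not_lt.2 (hsmall (φ n) hlt.le a1 a2 a3 a4 a5))
      obtain ⟨n, hn, hiso⟩ := (frequently_atTop.1 hm) (m + 1)
      exact hdist (hφ.injective.ne (by omega : m ≠ n)) hiso
    have hcore := (hΓ n).1
    refine ⟨Γ n, q n, h3, h4, h5, hcore, by omega, fun F hF S _ hS hmap => ?_, hN, h6.le⟩
    rw [Finset.card_eq_zero] at hS
    subst hS
    exact (hΓ n).2 ⟨F, hF, hmap.mapsTo (hcore.isZeroCore h3 h4)⟩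
  obtain ⟨K, d, hd, hK, hKw, hKa, hKg⟩ :=
    CRG.exists_core_of_large hF₀ hp0 hp1 w (Fintype.card F₀.V) 0 (by omega) hH0
  have hzero := hK.isZeroCore hp0 hp1
  have hno : ∀ F ∈ 𝓕, ∀ S ⊆ K.VW, S.card ≤ d → ¬ F.ClusterMapsTo K S := by
    intro F hF S hS hSd hmap
    obtain ⟨T, hST, hT, hTd⟩ := Finset.exists_subsuperset_card_eq hS hSd (by omega)
    exact hKa F hF T hT hTd (hmap.mono hST hT)
  refine ⟨K, ⟨hK, ?_⟩, hKg, by omega, ?_⟩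
  · rintro ⟨F, hF, hmap⟩
    exact hno F hF ∅ (Finset.empty_subset _) (by simp) (.of_mapsTo hzero hmap)
  · rintro r ℓ hℓ - hr S hS hSr ⟨F, hF, hmap⟩
    exact hno F hF S hS (by omega) (.of_mapsTo_dalmatian hzero hmap)
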